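/- Let $G$ be a (finite-dimensional, real) Lie group with Lie algebra $\mathfrak g$, $H\subset G$ a closed subgroup with Lie algebra $\mathfrak h$, and $\mathfrak g=\mathfrak h\oplus\mathfrak m$ a reductive decomposition, $\mathrm{Ad}(H)\mathfrak m\subset\mathfrak m$; write $U=U_{\mathfrak h}+U_{\mathfrak m}$ for the corresponding parts of $U\in\mathfrak g$. Let $M=G/H$ carry a $G$-invariant Riemannian metric, given by an $\mathrm{Ad}(H)$-invariant inner product $\langle\,,\rangle$ on $\mathfrak m$, that is naturally reductive: $\langle[X,Y]_{\mathfrak m},Z\rangle+\langle Y,[X,Z]_{\mathfrak m}\rangle=0$ for $X,Y,Z\in\mathfrak m$. Let $Q$ be an $\mathrm{Ad}(G)$-invariant, symmetric, non-degenerate (not necessarily definite) bilinear form on $\mathfrak g$ with $Q(\mathfrak h,\mathfrak m)=0$ and $Q|_{\mathfrak m}=\langle\,,\rangle$, and put $Q_{\mathfrak h}(U,V)=Q(U_{\mathfrak h},V_{\mathfrak h})$, $Q_{\mathfrak m}(U,V)=Q(U_{\mathfrak m},V_{\mathfrak m})$. Let $\mathcal C(\mathfrak m)$ be the Clifford algebra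 with $v\cdot w+w\cdot v=-2\langle v,w\rangle$, let $\Delta_{\mathfrak m}$ be the complex spinor module (an irreducible complex representation of $\mathcal C(\mathfrak m)$, whose restriction to $\mathrm{Spin}(\mathfrak m)$ is $\kappa$), and assume that $M$ has a homogeneous spin structure, i.e. a continuous homomorphism $\widetilde{\mathrm{Ad}}:H\to\mathrm{Spin}(\mathfrak m)$ lifting $\mathrm{Ad}:H\to\mathrm{SO}(\mathfrak m)$ along the spin covering $\lambda$. Spinor fields are the smooth functions $\psi:G\to\Delta_{\mathfrak m}$ with $\psi(gh)=\kappa(\widetilde{\mathrm{Ad}}(h^{-1}))\psi(g)$ for $g\in G$, $h\in H$; for $X\in\mathfrak g$, $X(\psi)$ is the derivative of $\psi$ along the left-invariant vector field $X$. For $t\in\mathbb R$ let $\nabla^t$ be the $G$-invariant metric connection given by $\Lambda^t(X)Y=t[X,Y]_{\mathfrak m}$; on spinors $\nabla^t_Z\psi=Z(\psi)+\widetilde\Lambda^t(Z)\cdot\psi$ with $\widetilde\Lambda^t=(d\lambda)^{-1}\circ\Lambda^t:\mathfrak m\to\mathfrak{spin}(\mathfrak m)\subset\mathcal C(\mathfrak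 m)$. Let $Z_1,\dots,Z_n$ be an orthonormal basis of $\mathfrak m$, and $X_i$, $Y_i$ bases of $\mathfrak h$ with $Q(X_i,Y_j)=\delta_{ij}$. The Dirac operator of $\nabla^t$ is $D^t\psi=\sum_i Z_i\cdot\nabla^t_{Z_i}\psi$. With $\widetilde{\mathrm{ad}}(X)=(d\lambda)^{-1}(\mathrm{ad}(X)|_{\mathfrak m})$ for $X\in\mathfrak h$, put $$\widetilde C_{\mathfrak h}=-\sum_i\widetilde{\mathrm{ad}}(X_i)\cdot\widetilde{\mathrm{ad}}(Y_i),\qquad \Omega_{\mathfrak g}\psi=-\sum_i Z_i(Z_i(\psi))+\widetilde C_{\mathfrak h}\cdot\psi .$$ Finally let $$\mathrm{Jac}_{\mathfrak m}(X,Y,Z)=[X,[Y,Z]_{\mathfrak m}]_{\mathfrak m}+[Y,[Z,X]_{\mathfrak m}]_{\mathfrak m}+[Z,[X,Y]_{\mathfrak m}]_{\mathfrak m},$$ $$\mathrm{Jac}_{\mathfrak h}(X,Y,Z)=[X,[Y,Z]_{\mathfrak h}]+[Y,[Z,X]_{\mathfrak h}]+[Z,[X,Y]_{\mathfrak h}].$$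 Theorem (general Kostant–Parthasarathy formula). For every $t\in\mathbb R$ and every spinor field $\psi$: if $n\ge 5$, then $$\begin{aligned}(D^t)^2\psi={}&\Omega_{\mathfrak g}(\psi)+\tfrac12(1-3t)\sum_{i,j,k}\langle[Z_i,Z_j]_{\mathfrak m},Z_k\rangle\,Z_i\cdot Z_j\cdot Z_k(\psi)\\&-\tfrac12\sum_{i<j<k<l}\langle Z_i,\mathrm{Jac}_{\mathfrak h}(Z_j,Z_k,Z_l)+9t^2\,\mathrm{Jac}_{\mathfrak m}(Z_j,Z_k,Z_l)\rangle\,Z_i\cdot Z_j\cdot Z_k\cdot Z_l\cdot\psi\\&+\tfrac18\sum_{i,j}Q_{\mathfrak h}([Z_i,Z_j],[Z_i,Z_j])\,\psi+\tfrac38t^2\sum_{i,j}Q_{\mathfrak m}([Z_i,Z_j],[Z_i,Z_j])\,\psi .\end{aligned}$$ If $n\le 4$, the same formula holds with the term $9t^2\,\mathrm{Jac}_{\mathfrak m}(Z_j,Z_k,Z_l)$ omitted. (In the first-order term, $Z_k$ acts as a derivative and $Z_i,Z_j$ by Clifford multiplication.) -/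

import Mathlib

open scoped Manifold ContDiff

noncomputable section

namespace NatRed

section LieGroup

variable {E : Type*} [NormedAddCommGroup E] [NormedSpace ℝ E]
  {G : Type*} [TopologicalSpace G] [ChartedSpace E G] [Group G]

/-- The adjoint representation: `Ad g` is the differential at `1` of the conjugation
`x ↦ g x g⁻¹`. -/
def Ad (g : G) : GroupLieAlgebra 𝓘(ℝ, E) G →ₗ[ℝ] GroupLieAlgebra 𝓘(ℝ, E) G :=
  (mfderiv 𝓘(ℝ, E) 𝓘(ℝ, E) (fun x : G => g * x * g⁻¹) 1 : E →L[ℝ] E).toLinearMap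

/-- `X` is the velocity at `0` of a smooth one-parameter group `s ↦ exp (s X)` contained in `H`. -/
def IsGeneratorIn (H : Subgroup G) (X : GroupLieAlgebra 𝓘(ℝ, E) G) : Prop :=
  ∃ γ : ℝ → G, ContMDiff 𝓘(ℝ, ℝ) 𝓘(ℝ, E) ∞ γ ∧ (∀ s t, γ (s + t) = γ s * γ t) ∧
    (∀ s, γ s ∈ H) ∧ (mfderiv 𝓘(ℝ, ℝ) 𝓘(ℝ, E) γ 0 : ℝ →L[ℝ] E) 1 = X

variable (E) in
/-- The Lie algebra of a closed subgroup `H` of `G`, inside the Lie algebra of `G`: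
all `X` with `exp (s X) ∈ H` for all `s`. (For closed `H` this set is already a linear subspace, so
that taking the span adds nothing.) -/
def lieAlg (H : Subgroup G) : Submodule ℝ (GroupLieAlgebra 𝓘(ℝ, E) G) :=
  Submodule.span ℝ {X | IsGeneratorIn H X}

/-- The derivative `X(ψ)` of a vector valued function `ψ` on `G` along the left invariant vector
field induced by `X`, i.e. `X(ψ)(g) = d/ds ψ (g exp (s X))` at `s = 0`. -/
def leftDeriv {V : Type*} [NormedAddCommGroup V] [NormedSpace ℝ V]
    (X : GroupLieAlgebra 𝓘(ℝ, E) G) (ψ : G → V) (g : G) : V :=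
  (mfderiv 𝓘(ℝ, E) 𝓘(ℝ, V) ψ g : E →L[ℝ] V) (mulInvariantVectorField X g)

end LieGroup

/-- A naturally reductive homogeneous space `G/H`: a reductive complement `𝔪` of the Lie algebra
`𝔥` of `H`, together with a homogeneous Riemannian metric on `G/H`, i.e. an `Ad(H)`-invariant
positive definite inner product on `𝔪`, for which all the maps `[X, -]_𝔪` are skew symmetric. -/
structure Space (E : Type*) [NormedAddCommGroup E] [NormedSpace ℝ E]
    {G : Type*} [TopologicalSpace G] [ChartedSpace E G] [Group G] (H : Subgroup G) where
  /-- the reductive complement -/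
  𝔪 : Submodule ℝ (GroupLieAlgebra 𝓘(ℝ, E) G)
  isCompl : IsCompl 𝔪 (lieAlg E H)
  Ad_mem : ∀ h ∈ H, ∀ X ∈ 𝔪, Ad (E := E) h X ∈ 𝔪
  /-- the inner product `⟨ , ⟩` on `𝔪` -/
  metric : LinearMap.BilinForm ℝ 𝔪
  symm : ∀ X Y, metric X Y = metric Y X
  pos : ∀ X, X ≠ 0 → 0 < metric X X
  Ad_invariant : ∀ (h : G) (hh : h ∈ H) (X Y : 𝔪),
    metric ⟨Ad h X, Ad_mem h hh X X.2⟩ ⟨Ad h Y, Ad_mem h hh Y Y.2⟩ = metric X Y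
  naturally_reductive : ∀ X Y Z : 𝔪,
    metric (𝔪.projectionOnto (lieAlg E H) isCompl
        ⁅(X : GroupLieAlgebra 𝓘(ℝ, E) G), (Y : GroupLieAlgebra 𝓘(ℝ, E) G)⁆) Z +
      metric Y (𝔪.projectionOnto (lieAlg E H) isCompl
        ⁅(X : GroupLieAlgebra 𝓘(ℝ, E) G), (Z : GroupLieAlgebra 𝓘(ℝ, E) G)⁆) = 0

namespace Space

variable {E : Type*} [NormedAddCommGroup E] [NormedSpace ℝ E]
  {G : Type*} [TopologicalSpace G] [ChartedSpace E G] [Group G] {H : Subgroup G}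
  (M : Space E H)

/-- The `𝔪`-part `U_𝔪` of an element `U` of the Lie algebra. -/
def prM : GroupLieAlgebra 𝓘(ℝ, E) G →ₗ[ℝ] M.𝔪 :=
  M.𝔪.projectionOnto (lieAlg E H) M.isCompl

/-- The `𝔥`-part `U_𝔥` of an element `U` of the Lie algebra. -/
def prH : GroupLieAlgebra 𝓘(ℝ, E) G →ₗ[ℝ] lieAlg E H :=
  (lieAlg E H).projectionOnto M.𝔪 M.isCompl.symm

/-- The bracket `[X, Y]` of two elements of `𝔪`. -/
def br (X Y : M.𝔪) : GroupLieAlgebra 𝓘(ℝ, E) G :=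
  ⁅(X : GroupLieAlgebra 𝓘(ℝ, E) G), (Y : GroupLieAlgebra 𝓘(ℝ, E) G)⁆

/-- `[X, Y]_𝔪`. -/
def brM (X Y : M.𝔪) : M.𝔪 := M.prM (M.br X Y)

/-- `[X, Y]_𝔥`. -/
def brH (X Y : M.𝔪) : lieAlg E H := M.prH (M.br X Y)

/-- The differential `ad : 𝔥 → 𝔰𝔬(𝔪)` of the isotropy representation, `Y ↦ [X, Y]`.
(The bracket `[X, Y]` lies in `𝔪`; the projection only records this.) -/
def adH (X : lieAlg E H) (Y : M.𝔪) : M.𝔪 :=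
  M.prM ⁅(X : GroupLieAlgebra 𝓘(ℝ, E) G), (Y : GroupLieAlgebra 𝓘(ℝ, E) G)⁆

/-- `Jac_𝔪(X, Y, Z) = [X, [Y, Z]_𝔪]_𝔪 + [Y, [Z, X]_𝔪]_𝔪 + [Z, [X, Y]_𝔪]_𝔪`. -/
def jacM (X Y Z : M.𝔪) : M.𝔪 :=
  M.brM X (M.brM Y Z) + M.brM Y (M.brM Z X) + M.brM Z (M.brM X Y)

/-- `Jac_𝔥(X, Y, Z) = [X, [Y, Z]_𝔥] + [Y, [Z, X]_𝔥] + [Z, [X, Y]_𝔥]`.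
(The three summands lie in `𝔪`; the projection only records this.) -/
def jacH (X Y Z : M.𝔪) : M.𝔪 :=
  M.prM (⁅(X : GroupLieAlgebra 𝓘(ℝ, E) G), (M.brH Y Z : GroupLieAlgebra 𝓘(ℝ, E) G)⁆ +
    ⁅(Y : GroupLieAlgebra 𝓘(ℝ, E) G), (M.brH Z X : GroupLieAlgebra 𝓘(ℝ, E) G)⁆ +
    ⁅(Z : GroupLieAlgebra 𝓘(ℝ, E) G), (M.brH X Y : GroupLieAlgebra 𝓘(ℝ, E) G)⁆)

/-- `Q` is an `Ad(G)`-invariant symmetric non degenerate bilinear form on the Lie algebra of `G`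
(not necessarily definite) with `Q(𝔥, 𝔪) = 0` that extends the inner product of `𝔪`. -/
structure IsInvariantExtension (Q : LinearMap.BilinForm ℝ (GroupLieAlgebra 𝓘(ℝ, E) G)) :
    Prop where
  symm : ∀ U V, Q U V = Q V U
  nondegenerate : Q.Nondegenerate
  invariant : ∀ (g : G) (U V : GroupLieAlgebra 𝓘(ℝ, E) G), Q (Ad g U) (Ad g V) = Q U V
  orthogonal : ∀ (X : lieAlg E H) (Y : M.𝔪), Q X Y = 0
  extends_metric : ∀ X Y : M.𝔪, Q X Y = M.metric X Y

/-- The quadratic form `v ↦ -⟨v, v⟩`: Clifford multiplication satisfies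
`v · w + w · v = -2 ⟨v, w⟩`. -/
def form : QuadraticForm ℝ M.𝔪 := -M.metric.toQuadraticMap

/-- The Clifford algebra `𝒞(𝔪)`. -/
abbrev Cl : Type _ := CliffordAlgebra M.form

/-- The inclusion `𝔪 → 𝒞(𝔪)`. -/
abbrev inc : M.𝔪 →ₗ[ℝ] M.Cl := CliffordAlgebra.ι M.form

/-- The Lie algebra `𝔰𝔭𝔦𝔫(𝔪) ⊂ 𝒞(𝔪)` of `Spin(𝔪)`, spanned by the products `v · w` of
orthogonal vectors. -/
def spin : Submodule ℝ M.Cl :=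
  Submodule.span ℝ {x | ∃ v w : M.𝔪, M.metric v w = 0 ∧ x = M.inc v * M.inc w}

open Classical in
/-- `dλ⁻¹(A)` for a skew symmetric endomorphism `A` of `𝔪`: the unique `x ∈ 𝔰𝔭𝔦𝔫(𝔪)` with
`x · v - v · x = A v` for all `v`, where `dλ(x) = (v ↦ x · v - v · x)` is the differential of the
spin covering `λ(s) = (v ↦ s · v · s⁻¹)`. -/
def spinLift (A : M.𝔪 → M.𝔪) : M.Cl :=
  if h : ∃ x ∈ M.spin, ∀ v, x * M.inc v - M.inc v * x = M.inc (A v) then h.choose else 0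

/-- A homogeneous spin structure: a continuous homomorphism `H → Spin(𝔪)` lifting the isotropy
representation `Ad : H → SO(𝔪)` along the spin covering. Continuity refers to the canonical
topology of the finite dimensional vector space `𝒞(𝔪)`. -/
structure SpinStructure where
  /-- the lift of `Ad` -/
  lift : H →* spinGroup M.form
  continuous : ∀ f : M.Cl →ₗ[ℝ] ℝ, Continuous fun h : H => f (lift h : M.Cl)
  covers : ∀ (h : H) (v : M.𝔪),
    (lift h : M.Cl) * M.inc v * ((lift h)⁻¹ : spinGroup M.form) =
      M.inc ⟨Ad (h : G) v, M.Ad_mem h h.2 v v.2⟩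

/-- The lift `ãd(X) ∈ 𝔰𝔭𝔦𝔫(𝔪)` of `ad(X) ∈ 𝔰𝔬(𝔪)`, for `X ∈ 𝔥`. -/
def adLift (X : lieAlg E H) : M.Cl := M.spinLift (M.adH X)

/-- The linear map `Λ^t : 𝔪 → 𝔰𝔬(𝔪)`, `Λ^t(X) Y = t [X, Y]_𝔪`, defining the invariant connection
`∇^t`. -/
def Lam (t : ℝ) (X Y : M.𝔪) : M.𝔪 := t • M.brM X Y

/-- The lift `C̃_𝔥 = -∑ ãd(X_i) ãd(Y_i)` of the Casimir operator of `𝔥` to the Clifford algebra,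
for dual bases `X_i`, `Y_i` of `𝔥`. -/
def casimirLift {ι : Type*} [Fintype ι] (X Y : ι → lieAlg E H) : M.Cl :=
  -∑ i, M.adLift (X i) * M.adLift (Y i)

section Spinors

variable {Δ : Type*} [NormedAddCommGroup Δ] [NormedSpace ℂ Δ]
  (c : M.Cl →ₐ[ℝ] Module.End ℂ Δ)

/-- The Clifford action `c` makes `Δ` the space of spinors: an irreducible complex representation
of the Clifford algebra. -/
def IsSpinorModule : Prop :=
  Nontrivial Δ ∧ ∀ W : Submodule ℂ Δ, (∀ x, ∀ w ∈ W, c x w ∈ W) → W = ⊥ ∨ W = ⊤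

/-- Smooth sections of the spinor bundle `G ×_H Δ`, as smooth functions `ψ : G → Δ` with
`ψ(g h) = κ(Ãd(h⁻¹)) ψ(g)`; the spin representation `κ` is the restriction of `c` to `Spin(𝔪)`. -/
structure IsSpinorField (σ : M.SpinStructure) (ψ : G → Δ) : Prop where
  smooth : ContMDiff 𝓘(ℝ, E) 𝓘(ℝ, Δ) ∞ ψ
  equivariant : ∀ (g : G) (h : H), ψ (g * h) = c (σ.lift h⁻¹ : M.Cl) (ψ g)

/-- The covariant derivative of spinors induced by `∇^t`:
`∇^t_Z ψ = Z(ψ) + Λ̃^t(Z) · ψ`, with `Λ̃^t = dλ⁻¹ ∘ Λ^t`. -/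
def nabla (t : ℝ) (Z : M.𝔪) (ψ : G → Δ) (g : G) : Δ :=
  leftDeriv (Z : GroupLieAlgebra 𝓘(ℝ, E) G) ψ g + c (M.spinLift (M.Lam t Z)) (ψ g)

/-- The Dirac operator `D^t ψ = ∑ Z_i · ∇^t_{Z_i} ψ`, for an orthonormal basis `Z_i` of `𝔪`. -/
def dirac {n : ℕ} (Z : Fin n → M.𝔪) (t : ℝ) (ψ : G → Δ) (g : G) : Δ :=
  ∑ i, c (M.inc (Z i)) (M.nabla c t (Z i) ψ g)

/-- The Casimir operator `Ω_𝔤 ψ = -∑ Z_i²(ψ) + C̃_𝔥 · ψ`, for an orthonormal basis `Z_i` of `𝔪` and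
dual bases `X_i`, `Y_i` of `𝔥`. -/
def Omega {n : ℕ} (Z : Fin n → M.𝔪) {ι : Type*} [Fintype ι] (X Y : ι → lieAlg E H)
    (ψ : G → Δ) (g : G) : Δ :=
  -(∑ i, leftDeriv (Z i : GroupLieAlgebra 𝓘(ℝ, E) G)
      (leftDeriv (Z i : GroupLieAlgebra 𝓘(ℝ, E) G) ψ) g) + c (M.casimirLift X Y) (ψ g)

/-- The first order operator `∑ ⟨[Z_i, Z_j]_𝔪, Z_k⟩ Z_i · Z_j · Z_k(ψ)`, in which `Z_k` acts as a
derivative and `Z_i`, `Z_j` by Clifford multiplication. -/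
def firstOrder {n : ℕ} (Z : Fin n → M.𝔪) (ψ : G → Δ) (g : G) : Δ :=
  ∑ i, ∑ j, ∑ k, M.metric (M.brM (Z i) (Z j)) (Z k) •
    c (M.inc (Z i) * M.inc (Z j)) (leftDeriv (Z k : GroupLieAlgebra 𝓘(ℝ, E) G) ψ g)

end Spinors

/-- The element `∑_{i<j<k<l} ⟨Z_i, J(Z_j, Z_k, Z_l)⟩ Z_i · Z_j · Z_k · Z_l` of `𝒞(𝔪)`. -/
def quartic {n : ℕ} (Z : Fin n → M.𝔪) (J : M.𝔪 → M.𝔪 → M.𝔪 → M.𝔪) : M.Cl :=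
  ∑ i, ∑ j ∈ Finset.Ioi i, ∑ k ∈ Finset.Ioi j, ∑ l ∈ Finset.Ioi k,
    M.metric (Z i) (J (Z j) (Z k) (Z l)) •
      (M.inc (Z i) * M.inc (Z j) * M.inc (Z k) * M.inc (Z l))

/-- `∑_{i,j} Q_𝔥([Z_i, Z_j], [Z_i, Z_j])`. -/
def scalarH {n : ℕ} (Q : LinearMap.BilinForm ℝ (GroupLieAlgebra 𝓘(ℝ, E) G))
    (Z : Fin n → M.𝔪) : ℝ :=
  ∑ i, ∑ j, Q (M.brH (Z i) (Z j)) (M.brH (Z i) (Z j))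

/-- `∑_{i,j} Q_𝔪([Z_i, Z_j], [Z_i, Z_j])`. -/
def scalarM {n : ℕ} (Q : LinearMap.BilinForm ℝ (GroupLieAlgebra 𝓘(ℝ, E) G))
    (Z : Fin n → M.𝔪) : ℝ :=
  ∑ i, ∑ j, Q (M.brM (Z i) (Z j)) (M.brM (Z i) (Z j))

end Space

end NatRed

end

/-!
The square of `D^t = ∑ Z_i · Z_i(·) + (t/4) W`, where `W = ∑ ⟨[Z_i, Z_j]_𝔪, Z_k⟩ Z_i · Z_j · Z_k` is
the Clifford cubic of the torsion three form, has three parts.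

* Second order: `∑ Z_i · Z_j · Z_i(Z_j(ψ))` is `-∑ Z_i(Z_i(ψ))` plus one half of
  `∑ Z_i · Z_j · [Z_i, Z_j](ψ)` (`leftDeriv_commutator`). The `𝔪`-part of the bracket gives the first
  order operator. In the directions of `𝔥`, a spinor field is differentiated by the Clifford action
  of `-ãd` (`IsSpinorField.leftDeriv_of_mem`), since the lift of a one-parameter group of `H` to
  `Spin(𝔪)` has the velocity `ãd(X)` (`hasVelocity_lift`). As `ãd(X)` is the bivector
  `¼ ∑ ⟨[X, Z_k], Z_l⟩ Z_k · Z_l` (`IsOrthonormal.spinLift_eq`), the `𝔥`-part is `-⅛` times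
  the quartic sum of `R_ijkl = Q_𝔥([Z_i, Z_j], [Z_k, Z_l])`. The Casimir element is `-1/16` times the
  same sum (`IsInvariantExtension.casimirLift_eq`), and the remaining half is rewritten by
  `IsCliffordFrame.quad_cyc_eq` as the sum of the cyclic part of `R`, which is a four form given by
  `Jac_𝔥`, and the scalar `⅛ ∑ R_ijij`.
* First order: `W` and `Z_k` have the anticommutator `-6 ∑ ⟨[Z_i, Z_j]_𝔪, Z_k⟩ Z_i · Z_j`
  (`IsCliffordFrame.cubic_anticommutator`), which changes the coefficient of the first order operator
  from `½` to `½ (1 - 3 t)`.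
* Order zero: `W²` is the sum of a four form given by `Jac_𝔪` and a scalar
  (`IsCliffordFrame.cubic_sq`). For `n ≤ 4` the four form vanishes, because
  `⟨[Z_i, Z_j]_𝔪, Z_a⟩ ⟨[Z_k, Z_l]_𝔪, Z_a⟩ = 0` when `a` is one of the indices `i, j, k, l`.

The analysis on `G` is done in the preferred chart at `1`, after left translation.
-/

open scoped Manifold ContDiff

noncomputable section

namespace NatRed

/-! ### Left invariant vector fields in the chart at the identity -/

section Lie
open Filter Topology Set
variable {E : Type*} [NormedAddCommGroup E] [NormedSpace ℝ E]
  {G : Type*} [TopologicalSpace G] [ChartedSpace E G] [Group G]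
  {V : Type*} [NormedAddCommGroup V] [NormedSpace ℝ V]

theorem mfderiv_eq_fderiv_chart {M : Type*} [TopologicalSpace M] [ChartedSpace E M] {f : M → V}
    {a : M} (hf : MDifferentiableAt 𝓘(ℝ, E) 𝓘(ℝ, V) f a) :
    (mfderiv 𝓘(ℝ, E) 𝓘(ℝ, V) f a : E →L[ℝ] V) =
      fderiv ℝ (fun y => f ((extChartAt 𝓘(ℝ, E) a).symm y)) (extChartAt 𝓘(ℝ, E) a a) := by
  have h : (mfderiv 𝓘(ℝ, E) 𝓘(ℝ, V) f a : E →L[ℝ] V) =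
      fderivWithin ℝ (fun y => f ((extChartAt 𝓘(ℝ, E) a).symm y)) (range 𝓘(ℝ, E))
        (extChartAt 𝓘(ℝ, E) a a) := if_pos hf
  rw [h, ModelWithCorners.range_eq_univ, fderivWithin_univ]

theorem tendsto_chart_symm {M : Type*} [TopologicalSpace M] [ChartedSpace E M] (a : M) :
    Tendsto (extChartAt 𝓘(ℝ, E) a).symm (𝓝 (extChartAt 𝓘(ℝ, E) a a)) (𝓝 a) := by
  have := (continuousAt_extChartAt_symm (I := 𝓘(ℝ, E)) a).tendsto
  rwa [extChartAt_to_inv] at this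

theorem mfderiv_eq_fderiv_charts {F : Type*} [NormedAddCommGroup F] [NormedSpace ℝ F]
    {M N : Type*} [TopologicalSpace M] [ChartedSpace F M] [TopologicalSpace N] [ChartedSpace E N]
    {f : M → N} {a : M} {b : N} (hab : f a = b) (hf : MDifferentiableAt 𝓘(ℝ, F) 𝓘(ℝ, E) f a) :
    (mfderiv 𝓘(ℝ, F) 𝓘(ℝ, E) f a : F →L[ℝ] E) =
      fderiv ℝ (fun y => extChartAt 𝓘(ℝ, E) b (f ((extChartAt 𝓘(ℝ, F) a).symm y)))
        (extChartAt 𝓘(ℝ, F) a a) := by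
  subst hab
  have h : (mfderiv 𝓘(ℝ, F) 𝓘(ℝ, E) f a : F →L[ℝ] E) =
      fderivWithin ℝ (fun y => extChartAt 𝓘(ℝ, E) (f a) (f ((extChartAt 𝓘(ℝ, F) a).symm y)))
        (range 𝓘(ℝ, F)) (extChartAt 𝓘(ℝ, F) a a) := if_pos hf
  rw [h, ModelWithCorners.range_eq_univ, fderivWithin_univ]

variable (E G) in
/-- The multiplication of `G`, read in the preferred chart at `1`. -/
def mulChart (p : E × E) : E :=
  extChartAt 𝓘(ℝ, E) (1 : G)
    ((extChartAt 𝓘(ℝ, E) (1 : G)).symm p.1 * (extChartAt 𝓘(ℝ, E) (1 : G)).symm p.2)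

variable (E G) in
/-- The conjugation `(g, x) ↦ g x g⁻¹`, read in the preferred chart at `1`. -/
def conjChart (p : E × E) : E :=
  extChartAt 𝓘(ℝ, E) (1 : G)
    ((extChartAt 𝓘(ℝ, E) (1 : G)).symm p.1 * (extChartAt 𝓘(ℝ, E) (1 : G)).symm p.2 *
      ((extChartAt 𝓘(ℝ, E) (1 : G)).symm p.1)⁻¹)

variable (G) in
/-- The left invariant vector field of `U`, read in the preferred chart at `1`. -/
def fieldChart (U : E) (x : E) : E :=
  fderiv ℝ (mulChart E G) (x, extChartAt 𝓘(ℝ, E) (1 : G) 1) (0, U)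

theorem mulChart_left :
    ∀ᶠ y in 𝓝 (extChartAt 𝓘(ℝ, E) (1 : G) 1),
      mulChart E G (extChartAt 𝓘(ℝ, E) (1 : G) 1, y) = y := by
  filter_upwards [extChartAt_target_mem_nhds (I := 𝓘(ℝ, E)) (1 : G)] with y hy
  simp only [mulChart, extChartAt_to_inv, one_mul]
  exact (extChartAt 𝓘(ℝ, E) (1 : G)).right_inv hy

theorem mulChart_right :
    ∀ᶠ y in 𝓝 (extChartAt 𝓘(ℝ, E) (1 : G) 1),
      mulChart E G (y, extChartAt 𝓘(ℝ, E) (1 : G) 1) = y := by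
  filter_upwards [extChartAt_target_mem_nhds (I := 𝓘(ℝ, E)) (1 : G)] with y hy
  simp only [mulChart, extChartAt_to_inv, mul_one]
  exact (extChartAt 𝓘(ℝ, E) (1 : G)).right_inv hy

/-- The chain rule for the right translations: differentiating `F (x y)` in `y` at `1` is
differentiating `F` along the left invariant field. -/
theorem fderiv_mulChart_snd {x : E} {F : E → V} {e : E} (he : e = extChartAt 𝓘(ℝ, E) (1 : G) 1)
    (hF : DifferentiableAt ℝ F (mulChart E G (x, e)))
    (hx : DifferentiableAt ℝ (mulChart E G) (x, e)) (U : E) :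
    fderiv ℝ (fun y => F (mulChart E G (x, y))) e U =
      fderiv ℝ F (mulChart E G (x, e)) (fieldChart G U x) := by
  subst he
  have h1 : HasFDerivAt (fun y : E => (x, y)) (ContinuousLinearMap.inr ℝ E E)
    (extChartAt 𝓘(ℝ, E) (1 : G) 1) := hasFDerivAt_prodMk_right _ _
  have h2 : HasFDerivAt (fun y => mulChart E G (x, y)) _ (extChartAt 𝓘(ℝ, E) (1 : G) 1) :=
    hx.hasFDerivAt.comp _ h1
  have h3 := HasFDerivAt.comp (g := F) (f := fun y => mulChart E G (x, y)) _ hF.hasFDerivAt h2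
  exact congrArg (fun L : E →L[ℝ] V => L U) h3.fderiv

theorem conjChart_left :
    ∀ᶠ y in 𝓝 (extChartAt 𝓘(ℝ, E) (1 : G) 1),
      conjChart E G (extChartAt 𝓘(ℝ, E) (1 : G) 1, y) = y := by
  filter_upwards [extChartAt_target_mem_nhds (I := 𝓘(ℝ, E)) (1 : G)] with y hy
  simp only [conjChart, extChartAt_to_inv, one_mul, inv_one, mul_one]
  exact (extChartAt 𝓘(ℝ, E) (1 : G)).right_inv hy

theorem conjChart_right (z : E) :
      conjChart E G (z, extChartAt 𝓘(ℝ, E) (1 : G) 1) = extChartAt 𝓘(ℝ, E) (1 : G) 1 := by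
  simp only [conjChart, extChartAt_to_inv, mul_one, mul_inv_cancel]

variable [LieGroup 𝓘(ℝ, E) ∞ G]

theorem contMDiffAt_chart_symm {M : Type*} [TopologicalSpace M] [ChartedSpace E M]
    [IsManifold 𝓘(ℝ, E) ∞ M] (a : M) :
    ContMDiffAt 𝓘(ℝ, E) 𝓘(ℝ, E) ∞ (extChartAt 𝓘(ℝ, E) a).symm (extChartAt 𝓘(ℝ, E) a a) :=
  (contMDiffOn_extChartAt_symm a).contMDiffAt (extChartAt_target_mem_nhds a)

theorem contDiffAt_mulChart :
    ContDiffAt ℝ ∞ (mulChart E G)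
      (extChartAt 𝓘(ℝ, E) (1 : G) 1, extChartAt 𝓘(ℝ, E) (1 : G) 1) := by
  rw [← contMDiffAt_iff_contDiffAt]
  set e := extChartAt 𝓘(ℝ, E) (1 : G) 1
  have h1 : ContMDiffAt 𝓘(ℝ, E × E) 𝓘(ℝ, E) ∞
      (fun p : E × E => (extChartAt 𝓘(ℝ, E) (1 : G)).symm p.1) (e, e) :=
    ContMDiffAt.comp (e, e) (contMDiffAt_chart_symm (1 : G)) contDiff_fst.contMDiff.contMDiffAt
  have h2 : ContMDiffAt 𝓘(ℝ, E × E) 𝓘(ℝ, E) ∞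
      (fun p : E × E => (extChartAt 𝓘(ℝ, E) (1 : G)).symm p.2) (e, e) :=
    ContMDiffAt.comp (e, e) (contMDiffAt_chart_symm (1 : G)) contDiff_snd.contMDiff.contMDiffAt
  have h3 := h1.mul h2
  refine ContMDiffAt.comp (e, e) (I' := 𝓘(ℝ, E)) ?_ h3
  refine contMDiffAt_extChartAt' ?_
  simp [e]

theorem contDiffAt_conjChart :
    ContDiffAt ℝ ∞ (conjChart E G)
      (extChartAt 𝓘(ℝ, E) (1 : G) 1, extChartAt 𝓘(ℝ, E) (1 : G) 1) := by
  rw [← contMDiffAt_iff_contDiffAt]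
  set e := extChartAt 𝓘(ℝ, E) (1 : G) 1
  have h1 : ContMDiffAt 𝓘(ℝ, E × E) 𝓘(ℝ, E) ∞
      (fun p : E × E => (extChartAt 𝓘(ℝ, E) (1 : G)).symm p.1) (e, e) :=
    ContMDiffAt.comp (e, e) (contMDiffAt_chart_symm (1 : G)) contDiff_fst.contMDiff.contMDiffAt
  have h2 : ContMDiffAt 𝓘(ℝ, E × E) 𝓘(ℝ, E) ∞
      (fun p : E × E => (extChartAt 𝓘(ℝ, E) (1 : G)).symm p.2) (e, e) :=
    ContMDiffAt.comp (e, e) (contMDiffAt_chart_symm (1 : G)) contDiff_snd.contMDiff.contMDiffAt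
  have h3 := (h1.mul h2).mul h1.inv
  refine ContMDiffAt.comp (e, e) (I' := 𝓘(ℝ, E)) ?_ h3
  refine contMDiffAt_extChartAt' ?_
  simp [e]

/-- The left invariant derivative as a partial derivative of the multiplication. -/
theorem leftDeriv_eq_fderiv {f : G → V} {k : G}
    (hf : MDifferentiableAt 𝓘(ℝ, E) 𝓘(ℝ, V) f k) (U : E) :
    leftDeriv (E := E) (G := G) U f k =
      fderiv ℝ (fun y => f (k * (extChartAt 𝓘(ℝ, E) (1 : G)).symm y))
        (extChartAt 𝓘(ℝ, E) (1 : G) 1) U := by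
  have hl : MDifferentiableAt 𝓘(ℝ, E) 𝓘(ℝ, E) (fun h : G => k * h) 1 :=
    (contMDiff_mul_left (I := 𝓘(ℝ, E)) (n := ∞)).mdifferentiable (by simp) 1
  have hf' : MDifferentiableAt 𝓘(ℝ, E) 𝓘(ℝ, V) f (k * 1) := by rwa [mul_one]
  have hc := mfderiv_comp (1 : G) hf' hl
  have key := mfderiv_eq_fderiv_chart (hf'.comp (1 : G) hl)
  have hk : (mfderiv 𝓘(ℝ, E) 𝓘(ℝ, V) f k : E →L[ℝ] V) =
    (mfderiv 𝓘(ℝ, E) 𝓘(ℝ, V) f (k * 1) : E →L[ℝ] V) := by rw [mul_one]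
  have : leftDeriv (E := E) (G := G) U f k =
    (mfderiv 𝓘(ℝ, E) 𝓘(ℝ, V) (f ∘ fun h : G => k * h) 1 : E →L[ℝ] V) U := by
    rw [hc]
    exact congrArg (fun L : E →L[ℝ] V => L (mulInvariantVectorField (I := 𝓘(ℝ, E)) U k)) hk
  rw [this, key]; rfl

theorem eventually_contDiffAt_mulChart :
    ∀ᶠ x in 𝓝 (extChartAt 𝓘(ℝ, E) (1 : G) 1),
      DifferentiableAt ℝ (mulChart E G) (x, extChartAt 𝓘(ℝ, E) (1 : G) 1) := by
  have h := ((contDiffAt_mulChart (E := E) (G := G)).of_le (m := 1) (by simp)).eventually (by simp)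
  have hc : ContinuousAt (fun x : E => (x, extChartAt 𝓘(ℝ, E) (1 : G) 1))
    (extChartAt 𝓘(ℝ, E) (1 : G) 1) := by fun_prop
  filter_upwards [hc.eventually h] with x hx
  exact hx.differentiableAt (by simp)

theorem contDiffAt_leftTranslate {f : G → V} {g : G}
    (hf : ContMDiffAt 𝓘(ℝ, E) 𝓘(ℝ, V) ∞ f g) :
    ContDiffAt ℝ ∞ (fun y => f (g * (extChartAt 𝓘(ℝ, E) (1 : G)).symm y))
      (extChartAt 𝓘(ℝ, E) (1 : G) 1) := by
  rw [← contMDiffAt_iff_contDiffAt]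
  have h1 := (contMDiffAt_const (c := g)).mul (contMDiffAt_chart_symm (E := E) (1 : G))
  refine ContMDiffAt.comp _ (I' := 𝓘(ℝ, E)) ?_ h1
  simpa using hf

/-- Near `g`, the function `leftDeriv U f` is the derivative of the left translate of `f` to the chart
at `1` along `fieldChart G U`. -/
theorem leftDeriv_eventually_eq {f : G → V} {g : G}
    (hf : ContMDiffAt 𝓘(ℝ, E) 𝓘(ℝ, V) ∞ f g) (U : E) :
    ∀ᶠ x in 𝓝 (extChartAt 𝓘(ℝ, E) (1 : G) 1),
      leftDeriv (E := E) (G := G) U f (g * (extChartAt 𝓘(ℝ, E) (1 : G)).symm x) =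
        fderiv ℝ (fun y => f (g * (extChartAt 𝓘(ℝ, E) (1 : G)).symm y)) x
          (fieldChart G U x) := by
  set s := (extChartAt 𝓘(ℝ, E) (1 : G)).symm
  set e := extChartAt 𝓘(ℝ, E) (1 : G) 1
  have hs : Tendsto s (𝓝 e) (𝓝 1) := tendsto_chart_symm 1
  have hgs : Tendsto (fun x => g * s x) (𝓝 e) (𝓝 g) := by
    have := (contMDiff_mul_left (I := 𝓘(ℝ, E)) (n := ∞) (a := g)).continuous.continuousAt.tendsto.comp hs
    simpa [Function.comp_def] using this
  have h1 := hgs.eventually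
    (contMDiffAt_iff_contMDiffAt_nhds (n := 1) (by simp) |>.1 (hf.of_le (by simp)))
  have h2 := (((contDiffAt_leftTranslate hf).of_le (m := 1) (by simp)).eventually (by simp))
  have hsrc : ∀ᶠ x in 𝓝 e, s x ∈ (extChartAt 𝓘(ℝ, E) (1 : G)).source :=
    hs.eventually (extChartAt_source_mem_nhds (I := 𝓘(ℝ, E)) (1 : G))
  filter_upwards [h1, h2, eventually_contDiffAt_mulChart (E := E) (G := G), mulChart_right,
    eventually_eventually_nhds.2 hsrc] with x hx1 hx2 hx3 hx4 hx5
  rw [leftDeriv_eq_fderiv (hx1.mdifferentiableAt (by simp))]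
  have hF : DifferentiableAt ℝ (fun y => f (g * s y)) (mulChart E G (x, e)) := by
    rw [hx4]; exact hx2.differentiableAt (by simp)
  have key := fderiv_mulChart_snd (G := G) rfl hF hx3 U
  rw [hx4] at key
  rw [← key]
  refine congrArg (fun L : E →L[ℝ] V => L U) (Filter.EventuallyEq.fderiv_eq ?_)
  have hm : ∀ᶠ y in 𝓝 e, s x * s y ∈ (extChartAt 𝓘(ℝ, E) (1 : G)).source := by
    have := (contMDiff_mul_left (I := 𝓘(ℝ, E)) (n := ∞) (a := s x)).continuous.continuousAt.tendsto.comp hs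
    refine this.eventually ?_
    rw [mul_one]
    exact (isOpen_extChartAt_source _).mem_nhds hx5.self_of_nhds
  filter_upwards [hm] with y hy
  simp only [mulChart]
  rw [PartialEquiv.left_inv _ hy, mul_assoc]

theorem hasFDerivAt_fieldChart (U : E) :
    HasFDerivAt (fieldChart G U)
      ((fderiv ℝ (fderiv ℝ (mulChart E G))
        (extChartAt 𝓘(ℝ, E) (1 : G) 1, extChartAt 𝓘(ℝ, E) (1 : G) 1)).flip (0, U) ∘L
          ContinuousLinearMap.inl ℝ E E)
      (extChartAt 𝓘(ℝ, E) (1 : G) 1) := by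
  set e := extChartAt 𝓘(ℝ, E) (1 : G) 1
  have h1 : HasFDerivAt (fun x : E => (x, e)) (ContinuousLinearMap.inl ℝ E E) e :=
    hasFDerivAt_prodMk_left _ _
  have h2 : HasFDerivAt (fderiv ℝ (mulChart E G)) _ (e, e) :=
    ((((contDiffAt_mulChart (E := E) (G := G)).of_le (m := 2) ENat.LEInfty.out).fderiv_right
      (m := 1) one_add_one_eq_two.le).differentiableAt
      (by simp)).hasFDerivAt
  have h3 : HasFDerivAt (fun x => fderiv ℝ (mulChart E G) (x, e)) _ e :=
    HasFDerivAt.comp (f := fun x : E => (x, e)) e h2 h1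
  have h4 := h3.clm_apply (hasFDerivAt_const ((0 : E), U) e)
  refine h4.congr_fderiv ?_
  rw [ContinuousLinearMap.comp_zero, zero_add]
  rfl

theorem fieldChart_one (U : E) : fieldChart G U (extChartAt 𝓘(ℝ, E) (1 : G) 1) = U := by
  have h : DifferentiableAt ℝ (fun y : E => y)
    (mulChart E G (extChartAt 𝓘(ℝ, E) (1 : G) 1, extChartAt 𝓘(ℝ, E) (1 : G) 1)) :=
    differentiableAt_fun_id
  have h1 := fderiv_mulChart_snd (G := G) rfl h
    (contDiffAt_mulChart.differentiableAt (by simp)) U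
  rw [Filter.EventuallyEq.fderiv_eq (mulChart_left (E := E) (G := G))] at h1
  simpa using h1.symm

/-- The bracket of the Lie algebra of `G` in the preferred chart at `1`: the antisymmetrized
mixed second derivative of the multiplication. -/
theorem bracket_eq_fderiv_fieldChart (W U : GroupLieAlgebra 𝓘(ℝ, E) G) :
    (⁅W, U⁆ : GroupLieAlgebra 𝓘(ℝ, E) G) =
      (fderiv ℝ (fieldChart (E := E) G U) (extChartAt 𝓘(ℝ, E) (1 : G) 1) W -
        fderiv ℝ (fieldChart (E := E) G W) (extChartAt 𝓘(ℝ, E) (1 : G) 1) U : E) := by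
  set e := extChartAt 𝓘(ℝ, E) (1 : G) 1
  have hφ : ContMDiffAt 𝓘(ℝ, E) 𝓘(ℝ, E) ∞ (extChartAt 𝓘(ℝ, E) (1 : G)) 1 :=
    contMDiffAt_extChartAt
  -- the pulled back fields in the definition of the bracket are the fields `fieldChart`
  have hpull : ∀ U : E, VectorField.mpullbackWithin 𝓘(ℝ, E) 𝓘(ℝ, E)
      (extChartAt 𝓘(ℝ, E) (1 : G)).symm
      (mulInvariantVectorField (U : GroupLieAlgebra 𝓘(ℝ, E) G)) (range 𝓘(ℝ, E))
      =ᶠ[𝓝 e] fieldChart G U := by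
    intro U
    filter_upwards [leftDeriv_eventually_eq hφ U,
      extChartAt_target_mem_nhds (I := 𝓘(ℝ, E)) (1 : G),
      eventually_eventually_nhds.2 (extChartAt_target_mem_nhds (I := 𝓘(ℝ, E)) (1 : G))]
      with x hx1 hx2 hx3
    have hid : fderiv ℝ (fun y => extChartAt 𝓘(ℝ, E) (1 : G)
        (1 * (extChartAt 𝓘(ℝ, E) (1 : G)).symm y)) x = ContinuousLinearMap.id ℝ E := by
      have : (fun y => extChartAt 𝓘(ℝ, E) (1 : G)
        (1 * (extChartAt 𝓘(ℝ, E) (1 : G)).symm y)) =ᶠ[𝓝 x] id := by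
        filter_upwards [hx3] with y hy
        rw [one_mul]; exact PartialEquiv.right_inv _ hy
      rw [this.fderiv_eq, fderiv_id]
    rw [hid, one_mul] at hx1
    rw [VectorField.mpullbackWithin_apply]
    have hinv := ContinuousLinearMap.inverse_eq
      (mfderivWithin_extChartAt_symm_comp_mfderiv_extChartAt (I := 𝓘(ℝ, E)) hx2)
      (mfderiv_extChartAt_comp_mfderivWithin_extChartAt_symm (I := 𝓘(ℝ, E)) hx2)
    exact (congrArg (fun L : E →L[ℝ] E => L (mulInvariantVectorField (I := 𝓘(ℝ, E)) U
      ((extChartAt 𝓘(ℝ, E) (1 : G)).symm x))) hinv).trans hx1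
  have key : ∀ (W U : E) (A B : E → E) (S : Set E), S = univ → A =ᶠ[𝓝 e] fieldChart G W →
      B =ᶠ[𝓝 e] fieldChart G U → VectorField.lieBracketWithin ℝ A B S e =
        fderiv ℝ (fieldChart G U) e W - fderiv ℝ (fieldChart G W) e U := by
    intro W U A B S hS hA hB
    rw [hS, VectorField.lieBracketWithin_univ, hA.lieBracket_vectorField_eq hB,
      VectorField.lieBracket, fieldChart_one, fieldChart_one]
  have hinv : (mfderiv 𝓘(ℝ, E) 𝓘(ℝ, E) (extChartAt 𝓘(ℝ, E) (1 : G)) 1 : E →L[ℝ] E).inverse =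
      ContinuousLinearMap.id ℝ E :=
    (congrArg (fun L : E →L[ℝ] E => L.inverse) mfderiv_extChartAt_self).trans
      ContinuousLinearMap.inverse_id
  exact (congrArg (fun L : E →L[ℝ] E => L _) hinv).trans
    (key W U _ _ _ (by simp) (hpull W) (hpull U))

end Lie

/-! ### Commutators of left invariant derivatives and the derivative of `Ad` -/

section Lie
open Filter Topology Set
variable {E : Type*} [NormedAddCommGroup E] [NormedSpace ℝ E]
  {G : Type*} [TopologicalSpace G] [ChartedSpace E G] [Group G]
  {V : Type*} [NormedAddCommGroup V] [NormedSpace ℝ V]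
  [LieGroup 𝓘(ℝ, E) ∞ G]

/-- The left invariant derivatives of a smooth function are differentiable. -/
theorem mdifferentiable_leftDeriv {ψ : G → V} (hψ : ContMDiff 𝓘(ℝ, E) 𝓘(ℝ, V) ∞ ψ)
    (U : GroupLieAlgebra 𝓘(ℝ, E) G) :
    MDifferentiable 𝓘(ℝ, E) 𝓘(ℝ, V) (leftDeriv U ψ) := by
  -- `Z(ψ)` is the fibre component of the tangent map of `ψ` composed with the vector field
  have hmin : minSmoothness ℝ 3 = 3 := minSmoothness_of_isRCLikeNormedField
  have : LieGroup 𝓘(ℝ, E) (minSmoothness ℝ 3) G := by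
    rw [hmin]; exact LieGroup.of_le (n := ∞) ENat.LEInfty.out
  have h1 := contMDiff_mulInvariantVectorField (I := 𝓘(ℝ, E)) (G := G) U
  have h2 : ContMDiff 𝓘(ℝ, E).tangent 𝓘(ℝ, V).tangent 1 (tangentMap 𝓘(ℝ, E) 𝓘(ℝ, V) ψ) :=
    hψ.contMDiff_tangentMap (m := 1) (by rw [one_add_one_eq_two]; exact ENat.LEInfty.out)
  have h3 := h2.comp (h1.of_le (by rw [minSmoothness_of_isRCLikeNormedField]; norm_num))
  have h4 := (contMDiff_snd_tangentBundle_modelSpace V 𝓘(ℝ, V) (n := 1)).comp h3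
  exact h4.mdifferentiable (by simp)

/-- Left invariant vector fields act on functions as a Lie algebra. The left translation to `g`
reduces this to the chart at `1`, where it is the formula for the Lie bracket of vector fields on a
vector space. -/
theorem leftDeriv_commutator {ψ : G → V} (hψ : ContMDiff 𝓘(ℝ, E) 𝓘(ℝ, V) ∞ ψ)
    (W U : GroupLieAlgebra 𝓘(ℝ, E) G) (g : G) :
    leftDeriv W (leftDeriv U ψ) g - leftDeriv U (leftDeriv W ψ) g = leftDeriv ⁅W, U⁆ ψ g := by
  have hΨ := contDiffAt_leftTranslate (hψ.contMDiffAt (x := g))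
  have h2 : ∀ W U : E, leftDeriv (E := E) W (leftDeriv (E := E) U ψ) g =
      fderiv ℝ (fun x => fderiv ℝ (fun y => ψ (g * (extChartAt 𝓘(ℝ, E) (1 : G)).symm y)) x
          (fieldChart G U x)) (extChartAt 𝓘(ℝ, E) (1 : G) 1) W := fun W U =>
    (leftDeriv_eq_fderiv (mdifferentiable_leftDeriv hψ U g) W).trans
      (congrArg (fun L : E →L[ℝ] V => L W)
        (Filter.EventuallyEq.fderiv_eq (leftDeriv_eventually_eq (hψ.contMDiffAt (x := g)) U)))
  have key : ∀ W U : E, _ := fun W U => VectorField.fderiv_apply_lieBracket hΨ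
    (by rw [minSmoothness_of_isRCLikeNormedField]; exact ENat.LEInfty.out)
    (hasFDerivAt_fieldChart (E := E) (G := G) U).differentiableAt
    (hasFDerivAt_fieldChart (E := E) (G := G) W).differentiableAt
  simp only [VectorField.lieBracket, fieldChart_one] at key
  have h3 := (leftDeriv_eq_fderiv (hψ.mdifferentiable (by simp) g)
    (⁅W, U⁆ : GroupLieAlgebra 𝓘(ℝ, E) G)).trans
    (congrArg (fderiv ℝ (fun y => ψ (g * (extChartAt 𝓘(ℝ, E) (1 : G)).symm y)) _)
      (bracket_eq_fderiv_fieldChart W U))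
  exact (congrArg₂ (· - ·) (h2 W U) (h2 U W)).trans ((key W U).symm.trans h3.symm)

/-- The adjoint representation is a partial derivative of the conjugation, read in the chart. -/
theorem Ad_eventually_eq :
    ∀ᶠ z in 𝓝 (extChartAt 𝓘(ℝ, E) (1 : G) 1), ∀ U : E,
      (Ad (E := E) ((extChartAt 𝓘(ℝ, E) (1 : G)).symm z) U : E) =
      fderiv ℝ (conjChart E G) (z, extChartAt 𝓘(ℝ, E) (1 : G) 1) (0, U) := by
  have h := ((contDiffAt_conjChart (E := E) (G := G)).of_le (m := 1) (by simp)).eventually (by simp)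
  have hc : ContinuousAt (fun x : E => (x, extChartAt 𝓘(ℝ, E) (1 : G) 1))
    (extChartAt 𝓘(ℝ, E) (1 : G) 1) := by fun_prop
  filter_upwards [hc.eventually h] with z hz U
  set g := (extChartAt 𝓘(ℝ, E) (1 : G)).symm z
  have hconj : ContMDiff 𝓘(ℝ, E) 𝓘(ℝ, E) ∞ (fun x : G => g * x * g⁻¹) :=
    (contMDiff_const.mul contMDiff_id).mul contMDiff_const
  have h1 := mfderiv_eq_fderiv_charts (E := E) (f := fun x : G => g * x * g⁻¹) (a := 1) (b := 1)
    (by simp) (hconj.mdifferentiable (by simp) 1)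
  have h2 : HasFDerivAt (fun y => conjChart E G (z, y)) _ (extChartAt 𝓘(ℝ, E) (1 : G) 1) :=
    (hz.differentiableAt (by simp)).hasFDerivAt.comp _ (hasFDerivAt_prodMk_right _ _)
  exact (congrArg (fun L : E →L[ℝ] E => L U) h1).trans
    (congrArg (fun L : E →L[ℝ] E => L U) h2.fderiv)

/-- The identity `(g x g⁻¹) g = g x`, differentiated in `x` at `1`. -/
theorem fderiv_conjChart_eventually_eq (U : E) :
    ∀ᶠ z in 𝓝 (extChartAt 𝓘(ℝ, E) (1 : G) 1),
      fderiv ℝ (mulChart E G) (extChartAt 𝓘(ℝ, E) (1 : G) 1, z)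
        (fderiv ℝ (conjChart E G) (z, extChartAt 𝓘(ℝ, E) (1 : G) 1) (0, U), 0) =
      fieldChart G U z := by
  set s := (extChartAt 𝓘(ℝ, E) (1 : G)).symm
  set e := extChartAt 𝓘(ℝ, E) (1 : G) 1
  have hs : Tendsto s (𝓝 e) (𝓝 1) := tendsto_chart_symm 1
  have hK := ((contDiffAt_conjChart (E := E) (G := G)).of_le (m := 1) (by simp)).eventually (by simp)
  have hM := ((contDiffAt_mulChart (E := E) (G := G)).of_le (m := 1) (by simp)).eventually (by simp)
  have hc : ContinuousAt (fun x : E => (x, e)) e := by fun_prop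
  have hc' : ContinuousAt (fun x : E => (e, x)) e := by fun_prop
  filter_upwards [hc.eventually hK, hc.eventually hM, hc'.eventually hM] with z h1 h2 h3
  have d1 : HasFDerivAt (fun y => conjChart E G (z, y)) _ e :=
    (h1.differentiableAt (by simp)).hasFDerivAt.comp _ (hasFDerivAt_prodMk_right _ _)
  have d2 : HasFDerivAt (fun y => mulChart E G (z, y)) _ e :=
    (h2.differentiableAt (by simp)).hasFDerivAt.comp _ (hasFDerivAt_prodMk_right _ _)
  have d3 : HasFDerivAt (fun y => (conjChart E G (z, y), z))
      ((fderiv ℝ (conjChart E G) (z, e) ∘L ContinuousLinearMap.inr ℝ E E).prod 0) e :=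
    d1.prodMk (hasFDerivAt_const z e)
  have d4 : HasFDerivAt (mulChart E G) (fderiv ℝ (mulChart E G) (e, z)) (conjChart E G (z, e), z) := by
    rw [conjChart_right]; exact (h3.differentiableAt (by simp)).hasFDerivAt
  have d5 : HasFDerivAt (fun y => mulChart E G (conjChart E G (z, y), z)) _ e :=
    HasFDerivAt.comp (f := fun y => (conjChart E G (z, y), z)) e d4 d3
  have heq : (fun y => mulChart E G (conjChart E G (z, y), z)) =ᶠ[𝓝 e]
      fun y => mulChart E G (z, y) := by
    have hm : ∀ᶠ y in 𝓝 e, s z * s y * (s z)⁻¹ ∈ (extChartAt 𝓘(ℝ, E) (1 : G)).source := by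
      have hconj : ContMDiff 𝓘(ℝ, E) 𝓘(ℝ, E) ∞ (fun x : G => s z * x * (s z)⁻¹) :=
        (contMDiff_const.mul contMDiff_id).mul contMDiff_const
      refine (hconj.continuous.continuousAt.tendsto.comp hs).eventually ?_
      simpa using extChartAt_source_mem_nhds (I := 𝓘(ℝ, E)) (1 : G)
    filter_upwards [hm] with y hy
    simp only [mulChart, conjChart]
    rw [PartialEquiv.left_inv _ hy, inv_mul_cancel_right]
  have := d5.unique (d2.congr_of_eventuallyEq heq)
  exact congrArg (fun L : E →L[ℝ] E => L U) this

/-- The derivative of the adjoint representation is the bracket. In the chart at `1` this comes from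
differentiating the identity `(g x g⁻¹) g = g x` in `x` and in `g`, and from the symmetry of the
second derivative of the multiplication. -/
theorem hasFDerivAt_Ad (U : GroupLieAlgebra 𝓘(ℝ, E) G) :
    ∃ L : E →L[ℝ] E, (∀ W : GroupLieAlgebra 𝓘(ℝ, E) G, L W = ⁅W, U⁆) ∧
      HasFDerivAt (fun z : E => (Ad (E := E) ((extChartAt 𝓘(ℝ, E) (1 : G)).symm z) U : E)) L
        (extChartAt 𝓘(ℝ, E) (1 : G) 1) := by
  set e := extChartAt 𝓘(ℝ, E) (1 : G) 1
  suffices h : ∀ U : E, ∃ L : E →L[ℝ] E,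
      (∀ W : E, L W = fderiv ℝ (fieldChart G U) e W - fderiv ℝ (fieldChart G W) e U) ∧
      HasFDerivAt (fun z : E => fderiv ℝ (conjChart E G) (z, e) (0, U)) L e by
    obtain ⟨L, hL, hL'⟩ := h U
    refine ⟨L, fun W => (hL W).trans (bracket_eq_fderiv_fieldChart W U).symm,
      hL'.congr_of_eventuallyEq ?_⟩
    filter_upwards [Ad_eventually_eq (E := E) (G := G)] with z hz using hz U
  intro U
  have hc : HasFDerivAt (fun x : E => (x, e)) (ContinuousLinearMap.inl ℝ E E) e :=
    hasFDerivAt_prodMk_left _ _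
  have hc' : HasFDerivAt (fun x : E => (e, x)) (ContinuousLinearMap.inr ℝ E E) e :=
    hasFDerivAt_prodMk_right _ _
  have hK : HasFDerivAt (fderiv ℝ (conjChart E G)) _ (e, e) :=
    ((((contDiffAt_conjChart (E := E) (G := G)).of_le (m := 2) ENat.LEInfty.out).fderiv_right
      (m := 1) one_add_one_eq_two.le).differentiableAt (by simp)).hasFDerivAt
  have hM : HasFDerivAt (fderiv ℝ (mulChart E G)) _ (e, e) :=
    ((((contDiffAt_mulChart (E := E) (G := G)).of_le (m := 2) ENat.LEInfty.out).fderiv_right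
      (m := 1) one_add_one_eq_two.le).differentiableAt (by simp)).hasFDerivAt
  have hsymm : IsSymmSndFDerivAt ℝ (mulChart E G) (e, e) :=
    contDiffAt_mulChart.isSymmSndFDerivAt
      (by rw [minSmoothness_of_isRCLikeNormedField]; exact ENat.LEInfty.out)
  have hK1 : HasFDerivAt (fun x => fderiv ℝ (conjChart E G) (x, e)) _ e :=
    HasFDerivAt.comp (f := fun x : E => (x, e)) e hK hc
  have ha := hK1.clm_apply (hasFDerivAt_const ((0 : E), U) e)
  have hM1 : HasFDerivAt (fun x => fderiv ℝ (mulChart E G) (e, x)) _ e :=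
    HasFDerivAt.comp (f := fun x : E => (e, x)) e hM hc'
  have hprod := hM1.clm_apply (ha.prodMk (hasFDerivAt_const (0 : E) e))
  have huniq := hprod.unique
    ((hasFDerivAt_fieldChart (G := G) U).congr_of_eventuallyEq (fderiv_conjChart_eventually_eq U))
  refine ⟨_, fun W => ?_, ha⟩
  have h1 := congrArg (fun L : E →L[ℝ] E => L W) huniq
  rw [(hasFDerivAt_fieldChart (G := G) U).fderiv, (hasFDerivAt_fieldChart (G := G) W).fderiv]
  -- the chart reads `x ↦ x · 1` and `x ↦ 1 x 1⁻¹` as the identity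
  have hid : ∀ v : E, fderiv ℝ (mulChart E G) (e, e) (v, 0) = v := by
    intro v
    have : HasFDerivAt (fun y => mulChart E G (y, e)) _ e :=
      HasFDerivAt.comp (f := fun x : E => (x, e)) e
        (contDiffAt_mulChart.differentiableAt (by simp)).hasFDerivAt hc
    have h := this.unique ((hasFDerivAt_id e).congr_of_eventuallyEq
      (mulChart_right (E := E) (G := G)))
    exact congrArg (fun L : E →L[ℝ] E => L v) h
  have hid' : fderiv ℝ (conjChart E G) (e, e) (0, U) = U := by
    have : HasFDerivAt (fun y => conjChart E G (e, y)) _ e :=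
      HasFDerivAt.comp (f := fun x : E => (e, x)) e
        (contDiffAt_conjChart.differentiableAt (by simp)).hasFDerivAt hc'
    have h := this.unique ((hasFDerivAt_id e).congr_of_eventuallyEq
      (conjChart_left (E := E) (G := G)))
    exact congrArg (fun L : E →L[ℝ] E => L U) h
  have h2 : fderiv ℝ (mulChart E G) (e, e)
        (fderiv ℝ (fderiv ℝ (conjChart E G)) (e, e) (W, 0) (0, U), 0) +
      fderiv ℝ (fderiv ℝ (mulChart E G)) (e, e) (0, W) (fderiv ℝ (conjChart E G) (e, e) (0, U), 0) =
      fderiv ℝ (fderiv ℝ (mulChart E G)) (e, e) (W, 0) (0, U) := by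
    simp only [ContinuousLinearMap.comp_zero, zero_add] at h1
    exact h1
  rw [hid, hid', hsymm (0, W) (U, 0)] at h2
  rw [ContinuousLinearMap.comp_zero, zero_add]
  exact eq_sub_of_add_eq h2
end Lie

/-! ### Rules for left invariant derivatives, and derivatives along curves -/

section Lie
open Filter Topology Set
variable {E : Type*} [NormedAddCommGroup E] [NormedSpace ℝ E]
  {G : Type*} [TopologicalSpace G] [ChartedSpace E G] [Group G]
  {V : Type*} [NormedAddCommGroup V] [NormedSpace ℝ V]

theorem leftDeriv_add_left (X Y : GroupLieAlgebra 𝓘(ℝ, E) G) (ψ : G → V) (g : G) :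
    leftDeriv (X + Y) ψ g = leftDeriv X ψ g + leftDeriv Y ψ g := by
  have h := congrFun (mulInvariantVectorField_add X Y) g
  exact (congrArg (mfderiv 𝓘(ℝ, E) 𝓘(ℝ, V) ψ g : E →L[ℝ] V) h).trans (map_add _ _ _)

theorem leftDeriv_smul_left (a : ℝ) (X : GroupLieAlgebra 𝓘(ℝ, E) G) (ψ : G → V) (g : G) :
    leftDeriv (a • X) ψ g = a • leftDeriv X ψ g := by
  have h := congrFun (mulInvariantVectorField_smul a X) g
  exact (congrArg (mfderiv 𝓘(ℝ, E) 𝓘(ℝ, V) ψ g : E →L[ℝ] V) h).trans (map_smul _ _ _)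

theorem leftDeriv_linear_comp {V' : Type*} [NormedAddCommGroup V'] [NormedSpace ℝ V']
    (L : V →L[ℝ] V') {ψ : G → V} {g : G} (hψ : MDifferentiableAt 𝓘(ℝ, E) 𝓘(ℝ, V) ψ g)
    (X : GroupLieAlgebra 𝓘(ℝ, E) G) :
    leftDeriv X (fun h => L (ψ h)) g = L (leftDeriv X ψ g) := by
  have h : HasMFDerivAt 𝓘(ℝ, E) 𝓘(ℝ, V') (L ∘ ψ) g _ :=
    L.hasMFDerivAt.comp g hψ.hasMFDerivAt
  exact congrArg (fun L : E →L[ℝ] V' => L (mulInvariantVectorField X g)) h.mfderiv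

theorem leftDeriv_add {φ ψ : G → V} {g : G} (hφ : MDifferentiableAt 𝓘(ℝ, E) 𝓘(ℝ, V) φ g)
    (hψ : MDifferentiableAt 𝓘(ℝ, E) 𝓘(ℝ, V) ψ g) (X : GroupLieAlgebra 𝓘(ℝ, E) G) :
    leftDeriv X (fun h => φ h + ψ h) g = leftDeriv X φ g + leftDeriv X ψ g :=
  congrArg (fun L : E →L[ℝ] V => L (mulInvariantVectorField X g))
    (hφ.hasMFDerivAt.add hψ.hasMFDerivAt).mfderiv

theorem leftDeriv_sum {ι : Type} (s : Finset ι) {φ : ι → G → V} {g : G}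
    (hφ : ∀ i ∈ s, MDifferentiableAt 𝓘(ℝ, E) 𝓘(ℝ, V) (φ i) g) (X : GroupLieAlgebra 𝓘(ℝ, E) G) :
    leftDeriv X (fun h => ∑ i ∈ s, φ i h) g = ∑ i ∈ s, leftDeriv X (φ i) g := by
  have h := (HasMFDerivAt.sum (t := s) (f := φ)
    (f' := fun i => mfderiv 𝓘(ℝ, E) 𝓘(ℝ, V) (φ i) g) fun i hi => (hφ i hi).hasMFDerivAt).mfderiv
  have h' : (fun h => ∑ i ∈ s, φ i h) = ∑ i ∈ s, φ i := by ext; simp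
  rw [h']
  refine (congrArg (fun L : E →L[ℝ] V => L (mulInvariantVectorField X g)) h).trans ?_
  let D : ι → E →L[ℝ] V := fun i => mfderiv 𝓘(ℝ, E) 𝓘(ℝ, V) (φ i) g
  have h2 : ∀ v : E, (∑ i ∈ s, D i) v = ∑ i ∈ s, D i v := fun v => by simp
  exact h2 _

theorem Ad_one (U : GroupLieAlgebra 𝓘(ℝ, E) G) : Ad (E := E) (1 : G) U = U := by
  have h : (fun x : G => 1 * x * 1⁻¹) = id := by ext; simp
  have h' : ∀ f : G → G, f = id →
      (mfderiv 𝓘(ℝ, E) 𝓘(ℝ, E) f 1 : E →L[ℝ] E) = ContinuousLinearMap.id ℝ E := by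
    rintro f rfl; exact mfderiv_id
  exact congrArg (fun L : E →L[ℝ] E => L U) (h' _ h)

variable [LieGroup 𝓘(ℝ, E) ∞ G]

/-- The chain rule along a curve through `1`, in the preferred chart at `1`. -/
theorem hasDerivAt_comp_curve {γ : ℝ → G} (hγ : MDifferentiableAt 𝓘(ℝ, ℝ) 𝓘(ℝ, E) γ 0)
    (h1 : γ 0 = 1) {F : G → V} {L : E →L[ℝ] V}
    (hF : HasFDerivAt (fun z => F ((extChartAt 𝓘(ℝ, E) (1 : G)).symm z)) L
      (extChartAt 𝓘(ℝ, E) (1 : G) 1)) :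
    HasDerivAt (fun s => F (γ s)) (L ((mfderiv 𝓘(ℝ, ℝ) 𝓘(ℝ, E) γ 0 : ℝ →L[ℝ] E) 1)) 0 := by
  have h2 := mfderiv_eq_fderiv_charts h1 hγ
  have hd : DifferentiableAt ℝ (fun s => extChartAt 𝓘(ℝ, E) (1 : G) (γ s)) 0 := by
    rw [← mdifferentiableAt_iff_differentiableAt]
    have h3 : MDifferentiableAt 𝓘(ℝ, E) 𝓘(ℝ, E) (extChartAt 𝓘(ℝ, E) (1 : G)) (γ 0) := by
      rw [h1]; exact mdifferentiableAt_extChartAt (mem_chart_source E (1 : G))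
    exact h3.comp (0 : ℝ) hγ
  have hφ : HasDerivAt (fun s => extChartAt 𝓘(ℝ, E) (1 : G) (γ s))
      ((mfderiv 𝓘(ℝ, ℝ) 𝓘(ℝ, E) γ 0 : ℝ →L[ℝ] E) 1) 0 := by
    rw [h2]; exact hd.hasFDerivAt.hasDerivAt
  have hF' : HasFDerivAt (fun z => F ((extChartAt 𝓘(ℝ, E) (1 : G)).symm z)) L
      (extChartAt 𝓘(ℝ, E) (1 : G) (γ 0)) := by rwa [h1]
  refine (hF'.comp_hasDerivAt (0 : ℝ) hφ).congr_of_eventuallyEq ?_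
  have hsrc := hγ.continuousAt.eventually_mem
    (by rw [h1]; exact extChartAt_source_mem_nhds (I := 𝓘(ℝ, E)) (1 : G))
  filter_upwards [hsrc] with s hs
  simp only [Function.comp_apply]
  rw [PartialEquiv.left_inv _ hs]

theorem hasDerivAt_Ad_curve [FiniteDimensional ℝ E] {γ : ℝ → G}
    (hγ : MDifferentiableAt 𝓘(ℝ, ℝ) 𝓘(ℝ, E) γ 0) (h1 : γ 0 = 1) {X : GroupLieAlgebra 𝓘(ℝ, E) G}
    (hX : (mfderiv 𝓘(ℝ, ℝ) 𝓘(ℝ, E) γ 0 : ℝ →L[ℝ] E) 1 = X) (U : GroupLieAlgebra 𝓘(ℝ, E) G)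
    (f : GroupLieAlgebra 𝓘(ℝ, E) G →ₗ[ℝ] V) :
    HasDerivAt (fun s => f (Ad (E := E) (γ s) U)) (f ⁅X, U⁆) 0 := by
  obtain ⟨L, hL, hL'⟩ := hasFDerivAt_Ad U
  let f' : E →L[ℝ] V := LinearMap.toContinuousLinearMap (E := E) f
  have h := hasDerivAt_comp_curve hγ h1 (F := fun g : G => f (Ad (E := E) g U))
    (f'.hasFDerivAt.comp _ hL')
  exact h.congr_deriv (congrArg f ((congrArg L hX).trans (hL X)))

/-- The derivative of a function along a curve through `1`, translated to `g`. -/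
theorem hasDerivAt_mul_curve {γ : ℝ → G} (hγ : MDifferentiableAt 𝓘(ℝ, ℝ) 𝓘(ℝ, E) γ 0)
    (h1 : γ 0 = 1) {X : GroupLieAlgebra 𝓘(ℝ, E) G}
    (hX : (mfderiv 𝓘(ℝ, ℝ) 𝓘(ℝ, E) γ 0 : ℝ →L[ℝ] E) 1 = X) {ψ : G → V}
    (hψ : ContMDiff 𝓘(ℝ, E) 𝓘(ℝ, V) ∞ ψ) (g : G) :
    HasDerivAt (fun s => ψ (g * γ s)) (leftDeriv X ψ g) 0 := by
  have h := hasDerivAt_comp_curve hγ h1 (F := fun h : G => ψ (g * h))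
    ((contDiffAt_leftTranslate (hψ.contMDiffAt (x := g))).differentiableAt (by simp)).hasFDerivAt
  exact h.congr_deriv ((congrArg (fderiv ℝ (fun y => ψ (g * (extChartAt 𝓘(ℝ, E) (1 : G)).symm y))
    (extChartAt 𝓘(ℝ, E) (1 : G) 1)) hX).trans
    (leftDeriv_eq_fderiv (hψ.mdifferentiable (by simp) g) X).symm)

/-- An `Ad(G)`-invariant bilinear form is `ad`-invariant. -/
theorem bracket_invariant_of_Ad_invariant [FiniteDimensional ℝ E]
    (Q : LinearMap.BilinForm ℝ (GroupLieAlgebra 𝓘(ℝ, E) G))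
    (hQ : ∀ (g : G) (U V : GroupLieAlgebra 𝓘(ℝ, E) G), Q (Ad g U) (Ad g V) = Q U V)
    (W U V : GroupLieAlgebra 𝓘(ℝ, E) G) : Q ⁅W, U⁆ V + Q U ⁅W, V⁆ = 0 := by
  obtain ⟨L, hL, hL'⟩ := hasFDerivAt_Ad U
  obtain ⟨K, hK, hK'⟩ := hasFDerivAt_Ad V
  let B : E →L[ℝ] E →L[ℝ] ℝ := LinearMap.toContinuousBilinearMap (𝕜 := ℝ) (E := E) (F := E) Q
  have h1 := (B.hasFDerivAt.comp _ hL').clm_apply hK'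
  have h2 : (fun z : E => B (Ad (E := E) ((extChartAt 𝓘(ℝ, E) (1 : G)).symm z) U)
      (Ad (E := E) ((extChartAt 𝓘(ℝ, E) (1 : G)).symm z) V)) = fun _ => Q U V := by
    ext z; exact hQ _ U V
  have h3 : HasFDerivAt (fun z : E => B (Ad (E := E) ((extChartAt 𝓘(ℝ, E) (1 : G)).symm z) U)
      (Ad (E := E) ((extChartAt 𝓘(ℝ, E) (1 : G)).symm z) V)) (0 : E →L[ℝ] ℝ)
      (extChartAt 𝓘(ℝ, E) (1 : G) 1) := by
    rw [h2]; exact hasFDerivAt_const _ _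
  have h4 := congrArg (fun T : E →L[ℝ] ℝ => T W) (h1.unique h3)
  have h5 : B (Ad (E := E) ((extChartAt 𝓘(ℝ, E) (1 : G)).symm (extChartAt 𝓘(ℝ, E) (1 : G) 1)) U)
      (K W) + B (L W) (Ad (E := E) ((extChartAt 𝓘(ℝ, E) (1 : G)).symm
        (extChartAt 𝓘(ℝ, E) (1 : G) 1)) V) = 0 := h4
  rw [extChartAt_to_inv, Ad_one, Ad_one] at h5
  have h6 : Q U (K W) + Q (L W) V = 0 := h5
  rw [hL, hK] at h6
  rw [add_comm]; exact h6
end Lie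

/-! ### Clifford frames: even elements that commute with all vectors are scalars -/

section Clifford

/-- The images of an orthonormal basis in a Clifford algebra with `v · w + w · v = -2 ⟨v, w⟩`. -/
def IsCliffordFrame {A ι : Type*} [Ring A] [DecidableEq ι] (e : ι → A) : Prop :=
  ∀ i j, e i * e j + e j * e i = if i = j then -2 else 0

variable {A ι : Type*} [Ring A] [DecidableEq ι] {e : ι → A}

theorem IsCliffordFrame.anticomm (he : IsCliffordFrame e) {i j : ι} (h : i ≠ j) :
    e i * e j = -(e j * e i) := by
  have := he i j
  rw [if_neg h] at this
  exact eq_neg_of_add_eq_zero_left this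

theorem IsCliffordFrame.comm_or_anticomm_prod (he : IsCliffordFrame e) (i : ι) (l : List ι) :
    e i * (l.map e).prod = (l.map e).prod * e i ∨
      e i * (l.map e).prod = -((l.map e).prod * e i) := by
  induction l with
  | nil => simp
  | cons j t ih =>
    simp only [List.map_cons, List.prod_cons]
    by_cases hij : i = j
    · subst hij
      rcases ih with h | h
      · left; rw [h, ← mul_assoc, h]
      · right
        rw [mul_assoc (e i), ← mul_neg, ← h]
    · rw [← mul_assoc, he.anticomm hij, neg_mul, mul_assoc, mul_assoc]
      rcases ih with h | h
      · right; rw [h]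
      · left; rw [h]; simp

theorem IsCliffordFrame.prod_mul_of_notMem (he : IsCliffordFrame e) {i : ι} {l : List ι}
    (h : i ∉ l) : e i * (l.map e).prod = (-1) ^ l.length * ((l.map e).prod * e i) := by
  induction l with
  | nil => simp
  | cons j t ih =>
    simp only [List.mem_cons, not_or] at h
    simp only [List.map_cons, List.prod_cons, List.length_cons]
    rw [← mul_assoc, he.anticomm h.1, neg_mul, mul_assoc, ih h.2]
    have hc : e j * (-1) ^ t.length = (-1) ^ t.length * e j :=
      ((Commute.neg_one_left (e j)).pow_left _).symm.eq
    rw [← mul_assoc (e j), hc, pow_succ]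
    simp only [mul_assoc, neg_mul, mul_neg, one_mul]

theorem IsCliffordFrame.prod_erase (he : IsCliffordFrame e) {i : ι} {l : List ι} (h : i ∈ l) :
    (l.map e).prod = e i * ((l.erase i).map e).prod ∨
      (l.map e).prod = -(e i * ((l.erase i).map e).prod) := by
  induction l with
  | nil => simp at h
  | cons j t ih =>
    by_cases hij : j = i
    · subst hij; simp
    · have ht : i ∈ t := by
        rcases List.mem_cons.1 h with h | h
        · exact absurd h.symm hij
        · exact h
      rw [List.erase_cons_tail (by simpa using hij)]
      simp only [List.map_cons, List.prod_cons]
      rcases ih ht with h | h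
      · right; rw [h, ← mul_assoc, he.anticomm hij]; simp [mul_assoc]
      · left; rw [h, mul_neg, ← mul_assoc, he.anticomm hij]; simp [mul_assoc]

variable [Algebra ℝ A]

theorem IsCliffordFrame.sq (he : IsCliffordFrame e) (i : ι) : e i * e i = -1 := by
  have h := he i i
  rw [if_pos rfl] at h
  have h2 : (2 : ℝ) • (e i * e i + 1) = 0 := by
    rw [two_smul, add_add_add_comm, h]; norm_num
  have h3 : e i * e i + 1 = 0 := (smul_eq_zero.1 h2).resolve_left two_ne_zero
  exact eq_neg_of_add_eq_zero_left h3

/-- Reordering, with signs, and cancelling squares removes all repetitions from a product. -/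
theorem IsCliffordFrame.exists_nodup (he : IsCliffordFrame e) (l : List ι) :
    ∃ l' : List ι, l'.Nodup ∧ ((l.map e).prod = (l'.map e).prod ∨
      (l.map e).prod = -(l'.map e).prod) := by
  induction l with
  | nil => exact ⟨[], List.nodup_nil, Or.inl rfl⟩
  | cons i t ih =>
    obtain ⟨t', ht', h⟩ := ih
    by_cases hi : i ∈ t'
    · refine ⟨t'.erase i, ht'.erase i, ?_⟩
      simp only [List.map_cons, List.prod_cons]
      rcases h with h | h <;> rcases he.prod_erase hi with h' | h' <;> rw [h, h'] <;>
        simp [← mul_assoc, he.sq]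
    · refine ⟨i :: t', List.nodup_cons.2 ⟨hi, ht'⟩, ?_⟩
      simp only [List.map_cons, List.prod_cons]
      rcases h with h | h <;> rw [h] <;> simp

/-- A Clifford algebra is spanned by the products of distinct vectors of an orthonormal basis. -/
theorem IsCliffordFrame.span_nodup (he : IsCliffordFrame e)
    (hgen : Algebra.adjoin ℝ (Set.range e) = ⊤) :
    Submodule.span ℝ (Set.range fun l : {l : List ι // l.Nodup} => (l.1.map e).prod) = ⊤ := by
  rw [eq_top_iff, ← Algebra.top_toSubmodule, ← hgen, Algebra.adjoin_eq_span, Submodule.span_le]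
  intro x hx
  obtain ⟨l, hl, rfl⟩ := Submonoid.exists_list_of_mem_closure hx
  obtain ⟨l₀, rfl⟩ : ∃ l₀ : List ι, l₀.map e = l := by
    rw [← Set.mem_range, Set.range_list_map]; exact hl
  obtain ⟨l', hl', h⟩ := he.exists_nodup l₀
  have hmem : (l'.map e).prod ∈
      Submodule.span ℝ (Set.range fun l : {l : List ι // l.Nodup} => (l.1.map e).prod) :=
    Submodule.subset_span ⟨⟨l', hl'⟩, rfl⟩
  rcases h with h | h <;> rw [h]
  · exact hmem
  · exact Submodule.neg_mem _ hmem

theorem IsCliffordFrame.finiteDimensional [Fintype ι] (he : IsCliffordFrame e)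
    (hgen : Algebra.adjoin ℝ (Set.range e) = ⊤) : FiniteDimensional ℝ A := by
  refine ⟨Submodule.fg_def.2 ⟨_, Set.finite_range _, he.span_nodup hgen⟩⟩

/-- An even element `z` that commutes with the generators is a scalar: conjugation by each `e i` and
the grading involution act on the products of distinct `e i` by signs, and only the empty product is
fixed by all of them. -/
theorem IsCliffordFrame.mem_range_of_commute [Fintype ι] (he : IsCliffordFrame e)
    (hgen : Algebra.adjoin ℝ (Set.range e) = ⊤) (inv : A →ₐ[ℝ] A) (hinv : ∀ i, inv (e i) = -e i)
    {z : A} (hz : inv z = z) (hcomm : ∀ i, e i * z = z * e i) :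
    ∃ r : ℝ, z = algebraMap ℝ A r := by
  -- the averages over the group generated by conjugation by `e i`
  let P : ι → Module.End ℝ A := fun i =>
    (1 / 2 : ℝ) • (LinearMap.id - LinearMap.mulLeft ℝ (e i) ∘ₗ LinearMap.mulRight ℝ (e i))
  have hP : ∀ i x, P i x = (1 / 2 : ℝ) • (x - e i * (x * e i)) := fun i x => rfl
  let T : Module.End ℝ A := (Finset.univ.toList.map P).prod
  let P₀ : Module.End ℝ A := (1 / 2 : ℝ) • (LinearMap.id + inv.toLinearMap)
  have hP₀ : ∀ x, P₀ x = (1 / 2 : ℝ) • (x + inv x) := fun x => rfl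
  have hfix : ∀ i x, e i * x = x * e i → P i x = x := by
    intro i x h
    rw [hP, ← h, ← mul_assoc, he.sq, neg_mul, one_mul, sub_neg_eq_add, ← two_smul ℝ x, smul_smul]
    norm_num
  have hkill : ∀ i x, e i * x = -(x * e i) → P i x = 0 := by
    intro i x h
    have h' : x * e i = -(e i * x) := by rw [h, neg_neg]
    rw [hP, h', mul_neg, ← mul_assoc, he.sq]; simp
  have hTfix : ∀ (L : List ι) x, (∀ i ∈ L, P i x = x) → (L.map P).prod x = x := by
    intro L x
    induction L with
    | nil => simp
    | cons i t ih =>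
      intro h
      simp only [List.map_cons, List.prod_cons, Module.End.mul_apply]
      rw [ih fun j hj => h j (List.mem_cons_of_mem _ hj), h i List.mem_cons_self]
  have hTkill : ∀ (L : List ι) x, (∀ i, P i x = x ∨ P i x = 0) → (∃ i ∈ L, P i x = 0) →
      (L.map P).prod x = 0 := by
    intro L x hx
    have hx' : ∀ L : List ι, (L.map P).prod x = x ∨ (L.map P).prod x = 0 := by
      intro L
      induction L with
      | nil => simp
      | cons i t ih =>
        simp only [List.map_cons, List.prod_cons, Module.End.mul_apply]
        rcases ih with h | h <;> rw [h]
        · exact hx i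
        · simp
    induction L with
    | nil => simp
    | cons i t ih =>
      rintro ⟨j, hj, hj'⟩
      simp only [List.map_cons, List.prod_cons, Module.End.mul_apply]
      rcases List.mem_cons.1 hj with rfl | hjt
      · rcases hx' t with h | h <;> rw [h]
        · exact hj'
        · simp
      · rw [ih ⟨j, hjt, hj'⟩, map_zero]
  have hmain : ∀ x : A, ∃ r : ℝ, T (P₀ x) = algebraMap ℝ A r := by
    intro x
    have hx : x ∈ Submodule.span ℝ
        (Set.range fun l : {l : List ι // l.Nodup} => (l.1.map e).prod) := by
      rw [he.span_nodup hgen]; trivial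
    induction hx using Submodule.span_induction with
    | zero => exact ⟨0, by simp⟩
    | add x y _ _ hx hy =>
      obtain ⟨r, hr⟩ := hx
      obtain ⟨s, hs⟩ := hy
      exact ⟨r + s, by rw [map_add, map_add, map_add, hr, hs]⟩
    | smul a x _ hx =>
      obtain ⟨r, hr⟩ := hx
      exact ⟨a * r, by rw [map_smul, map_smul, hr, map_mul, Algebra.smul_def]⟩
    | mem x hx =>
      obtain ⟨⟨l, hl⟩, rfl⟩ := hx
      simp only
      have hinvl : ∀ l : List ι, inv (l.map e).prod = (-1) ^ l.length * (l.map e).prod := by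
        intro l
        induction l with
        | nil => simp
        | cons i t ih =>
          simp only [List.map_cons, List.prod_cons, map_mul, hinv, ih, List.length_cons, pow_succ]
          have hc : e i * (-1) ^ t.length = (-1) ^ t.length * e i :=
            ((Commute.neg_one_left (e i)).pow_left _).symm.eq
          rw [neg_mul, ← mul_assoc, hc]
          simp [mul_assoc]
      rcases Nat.even_or_odd l.length with hl' | hl'
      · have h0 : P₀ (l.map e).prod = (l.map e).prod := by
          rw [hP₀, hinvl, hl'.neg_one_pow, one_mul, ← two_smul ℝ, smul_smul]; norm_num
        rw [h0]
        match l, hl, hl' with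
        | [], _, _ =>
          refine ⟨1, ?_⟩
          rw [map_one]
          exact hTfix _ _ fun i _ => hfix i _ (by simp)
        | i :: t, hl, hl' =>
          refine ⟨0, ?_⟩
          rw [map_zero]
          refine hTkill _ _ (fun j => ?_) ⟨i, by simp, hkill i _ ?_⟩
          · rcases he.comm_or_anticomm_prod j (i :: t) with h | h
            · exact Or.inl (hfix j _ h)
            · exact Or.inr (hkill j _ h)
          · have hit := he.prod_mul_of_notMem (List.nodup_cons.1 hl).1
            have hodd : Odd t.length := by
              rw [List.length_cons, Nat.even_add_one] at hl'
              exact Nat.not_even_iff_odd.1 hl'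
            rw [hodd.neg_one_pow, neg_one_mul] at hit
            simp only [List.map_cons, List.prod_cons]
            rw [mul_assoc, ← mul_neg, hit]
      · refine ⟨0, ?_⟩
        have h0 : P₀ (l.map e).prod = 0 := by
          rw [hP₀, hinvl, hl'.neg_one_pow]; simp
        rw [h0, map_zero, map_zero]
  obtain ⟨r, hr⟩ := hmain z
  refine ⟨r, ?_⟩
  rw [← hr, hP₀, hz, ← two_smul ℝ, smul_smul]
  norm_num
  exact (hTfix _ z fun i _ => hfix i z (hcomm i)).symm
end Clifford

/-! ### Cubic and quartic elements of a Clifford algebra -/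

section Clifford

theorem sum_rotate {κ M : Type*} [Fintype κ] [AddCommMonoid M] (f : κ → κ → κ → M) :
    ∑ i, ∑ j, ∑ k, f j k i = ∑ i, ∑ j, ∑ k, f i j k := by
  rw [Finset.sum_comm]
  exact Finset.sum_congr rfl fun j _ => Finset.sum_comm

variable {A ι : Type*} [Ring A] [Algebra ℝ A] {e : ι → A}

section
variable [Fintype ι]

/-- The sum `∑ R_ijkl e_i e_j e_k e_l` over all indices. -/
def quad (e : ι → A) (R : ι → ι → ι → ι → ℝ) : A :=
  ∑ i, ∑ j, ∑ k, ∑ l, R i j k l • (e i * e j * e k * e l)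

/-- The cyclic sum of a 4-tensor over its first three indices. -/
def cyc (R : ι → ι → ι → ι → ℝ) (i j k l : ι) : ℝ := R i j k l + R j k i l + R k i j l

/-- Permuting the indices cyclically moves the cyclic sum from the coefficients to the products. -/
theorem quad_cyc (R : ι → ι → ι → ι → ℝ) :
    quad e (cyc R) = quad e R +
      ∑ i, ∑ j, ∑ k, ∑ l, R i j k l • ((e k * e i * e j + e j * e k * e i) * e l) := by
  have h1 := sum_rotate fun i j k => ∑ l, R i j k l • (e k * e i * e j * e l)
  have h2 := sum_rotate fun i j k => ∑ l, R k i j l • (e i * e j * e k * e l)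
  simp only [quad, cyc, add_smul, Finset.sum_add_distrib, add_mul, smul_add]
  rw [h1, ← h2, add_assoc]

end

variable [DecidableEq ι]

theorem IsCliffordFrame.add_swap (he : IsCliffordFrame e) (i j : ι) :
    e i * e j + e j * e i = (if i = j then (-2 : ℝ) else 0) • (1 : A) := by
  rw [he i j]
  split_ifs
  · rw [neg_smul, ofNat_smul_eq_nsmul ℝ 2 (1 : A)]; simp
  · simp

theorem IsCliffordFrame.commutator_mul (he : IsCliffordFrame e) (i j k : ι) :
    e i * e j * e k - e k * (e i * e j) =
      (if i = k then (2 : ℝ) else 0) • e j - (if j = k then (2 : ℝ) else 0) • e i := by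
  have h : e i * e j * e k - e k * (e i * e j) =
      e i * (e j * e k + e k * e j) - (e i * e k + e k * e i) * e j := by noncomm_ring
  rw [h, he.add_swap, he.add_swap]
  split_ifs <;> simp
  abel

theorem IsCliffordFrame.anticommutator_mul (he : IsCliffordFrame e) (k a b c : ι) :
    e k * (e a * e b * e c) + e a * e b * e c * e k =
      (if a = k then (-2 : ℝ) else 0) • (e b * e c) + (if b = k then (2 : ℝ) else 0) • (e a * e c) +
        (if c = k then (-2 : ℝ) else 0) • (e a * e b) := by
  have h : e k * (e a * e b * e c) + e a * e b * e c * e k =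
      (e a * e k + e k * e a) * (e b * e c) - e a * (e b * e k + e k * e b) * e c +
      e a * e b * (e c * e k + e k * e c) := by noncomm_ring
  rw [h, he.add_swap, he.add_swap, he.add_swap]
  split_ifs <;> simp

/-- The two cyclic rotations of a triple product, up to terms of degree one. -/
theorem IsCliffordFrame.cyclic_mul (he : IsCliffordFrame e) (i j k : ι) :
    e k * e i * e j + e j * e k * e i =
      (2 : ℝ) • (e i * e j * e k) + (if j = k then (2 : ℝ) else 0) • e i -
        (if i = k then (4 : ℝ) else 0) • e j + (if i = j then (2 : ℝ) else 0) • e k := by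
  have h : e k * e i * e j + e j * e k * e i = (e i * e j * e k + e i * e j * e k) +
      (e i * e k + e k * e i) * e j - e i * (e j * e k + e k * e j)
      + e j * (e i * e k + e k * e i) - (e i * e j + e j * e i) * e k := by noncomm_ring
  rw [h, he.add_swap, he.add_swap, he.add_swap, two_smul]
  split_ifs <;> simp <;> module

variable [Fintype ι]

/-- A symmetric matrix contributes to a sum of products of two vectors only through its trace. -/
theorem IsCliffordFrame.sum_symm (he : IsCliffordFrame e) {S : ι → ι → ℝ}
    (hS : ∀ i j, S i j = S j i) : ∑ i, ∑ j, S i j • (e i * e j) = -(∑ i, S i i) • (1 : A) := by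
  have h1 : ∑ i, ∑ j, S i j • (e i * e j) = ∑ i, ∑ j, S i j • (e j * e i) := by
    rw [Finset.sum_comm]
    exact Finset.sum_congr rfl fun i _ => Finset.sum_congr rfl fun j _ => by rw [hS]
  have h2 : (2 : ℝ) • ∑ i, ∑ j, S i j • (e i * e j) = (-2 : ℝ) • (∑ i, S i i) • (1 : A) := by
    rw [two_smul]
    nth_rewrite 2 [h1]
    simp only [← Finset.sum_add_distrib, ← smul_add, he.add_swap, ite_smul, smul_ite, zero_smul,
      smul_zero, Finset.sum_ite_eq, Finset.mem_univ, if_true, Finset.sum_smul, Finset.smul_sum]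
    exact Finset.sum_congr rfl fun i _ => smul_comm _ _ _
  have h3 := congrArg (fun x => (1 / 2 : ℝ) • x) h2
  simp only [smul_smul] at h3
  norm_num at h3
  rw [h3, neg_smul]
  congr 2
  ring

/-- The element `∑ a_ij e_i e_j` acts on vectors by commutators as the skew matrix `4 a`. -/
theorem IsCliffordFrame.commutator_sum (he : IsCliffordFrame e) {a : ι → ι → ℝ}
    (ha : ∀ i j, a i j = -a j i) (k : ι) :
    (∑ i, ∑ j, a i j • (e i * e j)) * e k - e k * (∑ i, ∑ j, a i j • (e i * e j)) =
      (4 : ℝ) • ∑ j, a k j • e j := by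
  have h1 : (∑ i, ∑ j, a i j • (e i * e j)) * e k - e k * (∑ i, ∑ j, a i j • (e i * e j)) =
      ∑ i, ∑ j, a i j • (e i * e j * e k - e k * (e i * e j)) := by
    simp only [Finset.sum_mul, Finset.mul_sum, ← Finset.sum_sub_distrib, smul_sub, smul_mul_assoc,
      mul_smul_comm]
  rw [h1]
  simp only [he.commutator_mul, smul_sub, Finset.sum_sub_distrib, ite_smul, smul_ite, zero_smul,
    smul_zero, Finset.sum_ite_eq', Finset.mem_univ, if_true]
  have h2 : ∑ i, ∑ j, (if i = k then a i j • (2 : ℝ) • e j else 0) = ∑ j, a k j • (2 : ℝ) • e j := by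
    rw [Finset.sum_comm]; simp
  rw [h2, Finset.smul_sum, ← Finset.sum_sub_distrib]
  refine Finset.sum_congr rfl fun j _ => ?_
  rw [ha j k]
  module

/-- A quartic sum with the symmetries of a curvature tensor, except for the Bianchi identity, differs
from the antisymmetric sum of its cyclic part by a scalar. -/
theorem IsCliffordFrame.quad_cyc_eq (he : IsCliffordFrame e) {R : ι → ι → ι → ι → ℝ}
    (h1 : ∀ i j k l, R i j k l = -R j i k l) (h2 : ∀ i j k l, R i j k l = R k l i j) :
    quad e (cyc R) = (3 : ℝ) • quad e R + (6 * ∑ i, ∑ j, R i j i j) • (1 : A) := by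
  have h0 : ∀ i k l, R i i k l = 0 := fun i k l => by linarith [h1 i i k l]
  rw [quad_cyc]
  have h3 : ∑ i, ∑ j, ∑ k, ∑ l, R i j k l • ((e k * e i * e j + e j * e k * e i) * e l) =
      (2 : ℝ) • quad e R + (6 : ℝ) • ∑ i, ∑ l, (∑ j, R i j j l) • (e i * e l) := by
    simp only [he.cyclic_mul, add_mul, sub_mul, smul_add, smul_sub, Finset.sum_add_distrib,
      Finset.sum_sub_distrib, ite_smul, zero_smul, ite_mul,
      zero_mul, smul_ite, smul_zero, Finset.sum_ite_irrel, Finset.sum_const_zero,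
      Finset.sum_ite_eq, Finset.mem_univ, if_true, h0]
    have h4 : ∑ i, ∑ j, ∑ l, R i j i l • ((4 : ℝ) • e j * e l) =
        -∑ i, ∑ j, ∑ l, R i j j l • ((4 : ℝ) • e i * e l) := by
      rw [Finset.sum_comm]
      simp only [← Finset.sum_neg_distrib]
      refine Finset.sum_congr rfl fun i _ => Finset.sum_congr rfl fun j _ =>
        Finset.sum_congr rfl fun l _ => ?_
      rw [h1 j i j l, neg_smul]
    have h5 : ∑ i, ∑ l, (∑ j, R i j j l) • (e i * e l) =
        ∑ i, ∑ j, ∑ l, R i j j l • (e i * e l) := by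
      simp only [Finset.sum_smul]
      exact Finset.sum_congr rfl fun i _ => Finset.sum_comm
    rw [h4, h5, quad]
    simp only [smul_mul_assoc, smul_comm _ (2 : ℝ), smul_comm _ (4 : ℝ), ← Finset.smul_sum]
    module
  rw [h3, he.sum_symm (S := fun i l => ∑ j, R i j j l)]
  · have h4 : ∑ i, ∑ j, R i j j i = -∑ i, ∑ j, R i j i j := by
      simp only [← Finset.sum_neg_distrib]
      rw [Finset.sum_comm]
      exact Finset.sum_congr rfl fun i _ => Finset.sum_congr rfl fun j _ => h1 j i i j
    rw [h4]
    module
  · intro i l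
    refine Finset.sum_congr rfl fun j _ => ?_
    rw [h2, h1, h2, h1, neg_neg, h2]

/-- The anticommutator of the Clifford cubic of a three form `T` with `e k` is a multiple of the
bivector obtained by contracting `T` with `e k`. -/
theorem IsCliffordFrame.cubic_anticommutator (he : IsCliffordFrame e) {T : ι → ι → ι → ℝ}
    (h1 : ∀ i j k, T i j k = -T j i k) (h2 : ∀ i j k, T i j k = -T i k j) (k : ι) :
    e k * (∑ i, ∑ j, ∑ k, T i j k • (e i * e j * e k)) +
      (∑ i, ∑ j, ∑ k, T i j k • (e i * e j * e k)) * e k =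
        (-6 : ℝ) • ∑ i, ∑ j, T i j k • (e i * e j) := by
  have hT : ∀ i j k, T i j k = T j k i := fun i j k => by rw [h1, h2, neg_neg]
  set W := ∑ i, ∑ j, ∑ k, T i j k • (e i * e j * e k) with hW
  let B : ι → A := fun k => ∑ i, ∑ j, T i j k • (e i * e j)
  have hB : ∀ k, B k = ∑ i, ∑ j, T k i j • (e i * e j) := fun k =>
    Finset.sum_congr rfl fun i _ => Finset.sum_congr rfl fun j _ => by rw [hT k i j]
  change e k * W + W * e k = (-6 : ℝ) • B k
  have h3 : e k * W + W * e k = ∑ a, ∑ b, ∑ c, T a b c •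
      (e k * (e a * e b * e c) + e a * e b * e c * e k) := by
    simp only [hW, Finset.sum_mul, Finset.mul_sum, ← Finset.sum_add_distrib, smul_add,
      smul_mul_assoc, mul_smul_comm]
  rw [h3]
  simp only [he.anticommutator_mul, smul_add, Finset.sum_add_distrib, ite_smul, zero_smul,
    smul_ite, smul_zero, Finset.sum_ite_irrel, Finset.sum_const_zero,
    Finset.sum_ite_eq', Finset.mem_univ, if_true]
  have h4 : ∑ x, ∑ y, T x k y • (2 : ℝ) • (e x * e y) = (-2 : ℝ) • B k := by
    rw [hB, Finset.smul_sum]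
    refine Finset.sum_congr rfl fun x _ => ?_
    rw [Finset.smul_sum]
    refine Finset.sum_congr rfl fun y _ => ?_
    rw [h1 x k y]; module
  have h5 : ∑ x, ∑ y, T x y k • (-2 : ℝ) • (e x * e y) = (-2 : ℝ) • B k := by
    simp only [B, Finset.smul_sum, smul_comm (-2 : ℝ)]
  have h6 : ∑ x, ∑ y, T k x y • (-2 : ℝ) • (e x * e y) = (-2 : ℝ) • B k := by
    simp only [hB, Finset.smul_sum, smul_comm (-2 : ℝ)]
  rw [h4, h5, h6]
  module

/-- The square of the Clifford cubic `W` of a three form `T`. With `B k` the contraction of `T` with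
`e k`, one has `W = ∑ B k * e k`; moving `e k` past the second factor `W` by its anticommutator, and
`B k` by its commutator, expresses `W * W` by `-W * W` and quartic sums. -/
theorem IsCliffordFrame.cubic_sq (he : IsCliffordFrame e) {T : ι → ι → ι → ℝ}
    (h1 : ∀ i j k, T i j k = -T j i k) (h2 : ∀ i j k, T i j k = -T i k j) :
    (∑ i, ∑ j, ∑ k, T i j k • (e i * e j * e k)) * (∑ i, ∑ j, ∑ k, T i j k • (e i * e j * e k)) =
      (-3 : ℝ) • quad e (cyc fun i j k l => ∑ a, T i j a * T k l a) +
        (6 * ∑ i, ∑ j, ∑ k, T i j k ^ 2) • (1 : A) := by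
  have hT : ∀ i j k, T i j k = T j k i := fun i j k => by rw [h1, h2, neg_neg]
  set R : ι → ι → ι → ι → ℝ := fun i j k l => ∑ a, T i j a * T k l a with hR
  set W := ∑ i, ∑ j, ∑ k, T i j k • (e i * e j * e k) with hW
  let B : ι → A := fun k => ∑ i, ∑ j, T i j k • (e i * e j)
  have hWB : W = ∑ k, B k * e k := by
    rw [hW, ← sum_rotate]
    simp only [B, Finset.sum_mul, smul_mul_assoc]
  -- the squares of the contractions
  have hBB : ∑ k, B k * B k = quad e R := by
    have h3 : ∀ a, B a * B a = ∑ i, ∑ j, ∑ k, ∑ l,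
        (T i j a * T k l a) • (e i * e j * e k * e l) := by
      intro a
      simp only [B, Finset.sum_mul]
      refine Finset.sum_congr rfl fun i _ => Finset.sum_congr rfl fun j _ => ?_
      simp only [Finset.mul_sum, smul_mul_smul_comm, mul_assoc]
    simp only [h3, quad, R, Finset.sum_smul]
    refine Finset.sum_comm.trans (Finset.sum_congr rfl fun i _ => ?_)
    refine Finset.sum_comm.trans (Finset.sum_congr rfl fun j _ => ?_)
    exact Finset.sum_comm.trans (Finset.sum_congr rfl fun k _ => Finset.sum_comm)
  have hB : ∀ k, B k = ∑ i, ∑ j, T k i j • (e i * e j) := fun k =>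
    Finset.sum_congr rfl fun i _ => Finset.sum_congr rfl fun j _ => by rw [hT k i j]
  have hanti : ∀ k, e k * W + W * e k = (-6 : ℝ) • B k := he.cubic_anticommutator h1 h2
  have hcomm : ∀ k l, B k * e l - e l * B k = (4 : ℝ) • ∑ m, T k l m • e m := by
    intro k l
    rw [he.commutator_sum (fun i j => h1 i j k)]
    congr 1
    exact Finset.sum_congr rfl fun m _ => by rw [hT k l m]
  -- the commutator of the quadratic part `B k` with the cubic `W`
  have hX : ∑ k, (B k * W - W * B k) * e k = (4 : ℝ) • quad e (cyc R) := by
    have h3 : ∀ k, B k * W - W * B k = ∑ m, ((B k * B m - B m * B k) * e m +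
        B m * (B k * e m - e m * B k)) := by
      intro k
      rw [hWB, Finset.mul_sum, Finset.sum_mul, ← Finset.sum_sub_distrib]
      refine Finset.sum_congr rfl fun m _ => ?_
      noncomm_ring
    have h4 : ∀ k m, B k * B m - B m * B k = (4 : ℝ) • ∑ i, ∑ j, ∑ p,
        (T i j m * T k i p) • (e p * e j) + (4 : ℝ) • ∑ i, ∑ j, ∑ p,
        (T i j m * T k j p) • (e i * e p) := by
      intro k m
      have h5 : B k * B m - B m * B k = ∑ i, ∑ j, T i j m •
          ((B k * e i - e i * B k) * e j + e i * (B k * e j - e j * B k)) := by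
        have : ∀ x y : A, ∀ z : A, (z * x - x * z) * y + x * (z * y - y * z) =
          z * (x * y) - (x * y) * z := fun x y z => by noncomm_ring
        simp only [this]
        generalize B k = z
        simp only [B, Finset.sum_mul, Finset.mul_sum, ← Finset.sum_sub_distrib, smul_sub,
          smul_mul_assoc, mul_smul_comm]
      rw [h5]
      simp only [hcomm, smul_add, Finset.sum_add_distrib, Finset.smul_sum, Finset.sum_mul,
        Finset.mul_sum, smul_mul_assoc, mul_smul_comm, smul_smul]
      congr 1 <;> refine Finset.sum_congr rfl fun i _ => Finset.sum_congr rfl fun j _ =>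
        Finset.sum_congr rfl fun p _ => ?_ <;> congr 1 <;> ring
    have h6 : ∑ k, ∑ m, B m * (B k * e m - e m * B k) * e k = (4 : ℝ) • quad e R := by
      rw [← hBB, Finset.sum_comm, Finset.smul_sum]
      refine Finset.sum_congr rfl fun m _ => ?_
      have : (4 : ℝ) • (B m * B m) = B m * ∑ k, ((4 : ℝ) • ∑ p, T k m p • e p) * e k := by
        rw [← mul_smul_comm]
        congr 1
        simp only [smul_mul_assoc, Finset.sum_mul, ← Finset.smul_sum]
        rw [Finset.sum_comm]
        refine congrArg _ (Finset.sum_congr rfl fun i _ => Finset.sum_congr rfl fun j _ => ?_)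
        rw [hT i j m, hT j m i]
      rw [this, Finset.mul_sum]
      exact Finset.sum_congr rfl fun k _ => by rw [hcomm, mul_assoc]
    have h7 : ∑ k, ∑ m, (B k * B m - B m * B k) * e m * e k =
        (4 : ℝ) • ∑ i, ∑ j, ∑ k, ∑ l, R i j k l • ((e k * e i * e j + e j * e k * e i) * e l) := by
      have hY1 : ∑ k, ∑ m, ∑ i, ∑ j, ∑ p, (T i j m * T k i p) • (e p * e j * e m * e k) =
          ∑ i, ∑ j, ∑ k, ∑ l, R i j k l • (e k * e i * e j * e l) := by
        simp only [R, Finset.sum_smul]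
        calc _ = ∑ k, ∑ m, ∑ j, ∑ i, ∑ p, (T i j m * T k i p) • (e p * e j * e m * e k) :=
              Finset.sum_congr rfl fun _ _ => Finset.sum_congr rfl fun _ _ => Finset.sum_comm
          _ = ∑ k, ∑ j, ∑ m, ∑ i, ∑ p, (T i j m * T k i p) • (e p * e j * e m * e k) :=
              Finset.sum_congr rfl fun _ _ => Finset.sum_comm
          _ = ∑ j, ∑ k, ∑ m, ∑ i, ∑ p, (T i j m * T k i p) • (e p * e j * e m * e k) :=
              Finset.sum_comm
          _ = ∑ j, ∑ m, ∑ k, ∑ i, ∑ p, (T i j m * T k i p) • (e p * e j * e m * e k) :=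
              Finset.sum_congr rfl fun _ _ => Finset.sum_comm
          _ = ∑ j, ∑ m, ∑ k, ∑ p, ∑ i, (T i j m * T k i p) • (e p * e j * e m * e k) :=
              Finset.sum_congr rfl fun _ _ => Finset.sum_congr rfl fun _ _ =>
                Finset.sum_congr rfl fun _ _ => Finset.sum_comm
          _ = ∑ j, ∑ m, ∑ p, ∑ k, ∑ i, (T i j m * T k i p) • (e p * e j * e m * e k) :=
              Finset.sum_congr rfl fun _ _ => Finset.sum_congr rfl fun _ _ => Finset.sum_comm
          _ = _ := by
            refine Finset.sum_congr rfl fun j _ => Finset.sum_congr rfl fun m _ =>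
              Finset.sum_congr rfl fun p _ => Finset.sum_congr rfl fun k _ =>
              Finset.sum_congr rfl fun i _ => ?_
            rw [hT i j m, ← hT p k i]
      have hY2 : ∑ k, ∑ m, ∑ i, ∑ j, ∑ p, (T i j m * T k j p) • (e i * e p * e m * e k) =
          ∑ i, ∑ j, ∑ k, ∑ l, R i j k l • (e j * e k * e i * e l) := by
        simp only [R, Finset.sum_smul]
        calc _ = ∑ m, ∑ k, ∑ i, ∑ j, ∑ p, (T i j m * T k j p) • (e i * e p * e m * e k) :=
              Finset.sum_comm
          _ = ∑ m, ∑ i, ∑ k, ∑ j, ∑ p, (T i j m * T k j p) • (e i * e p * e m * e k) :=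
              Finset.sum_congr rfl fun _ _ => Finset.sum_comm
          _ = ∑ m, ∑ i, ∑ k, ∑ p, ∑ j, (T i j m * T k j p) • (e i * e p * e m * e k) :=
              Finset.sum_congr rfl fun _ _ => Finset.sum_congr rfl fun _ _ =>
                Finset.sum_congr rfl fun _ _ => Finset.sum_comm
          _ = ∑ m, ∑ i, ∑ p, ∑ k, ∑ j, (T i j m * T k j p) • (e i * e p * e m * e k) :=
              Finset.sum_congr rfl fun _ _ => Finset.sum_congr rfl fun _ _ => Finset.sum_comm
          _ = _ := by
            refine Finset.sum_congr rfl fun m _ => Finset.sum_congr rfl fun i _ =>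
              Finset.sum_congr rfl fun p _ => Finset.sum_congr rfl fun k _ =>
              Finset.sum_congr rfl fun j _ => ?_
            rw [← hT m i j, ← hT p k j]
      simp only [add_mul, smul_add, Finset.sum_add_distrib]
      rw [← hY1, ← hY2]
      simp only [h4, add_mul, smul_mul_assoc, Finset.sum_mul, Finset.sum_add_distrib,
        Finset.smul_sum]
    rw [quad_cyc, smul_add, ← h6, ← h7, ← Finset.sum_add_distrib]
    refine Finset.sum_congr rfl fun k _ => ?_
    rw [h3, Finset.sum_mul, ← Finset.sum_add_distrib]
    exact Finset.sum_congr rfl fun m _ => by rw [add_mul]; abel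
  -- the relation that determines `W * W`
  have h8 : W * W = -(6 : ℝ) • quad e R - (W * W + (4 : ℝ) • quad e (cyc R)) := by
    have h9 : W * W + (4 : ℝ) • quad e (cyc R) = ∑ k, B k * W * e k := by
      rw [← hX]
      nth_rewrite 2 [hWB]
      rw [Finset.mul_sum, ← Finset.sum_add_distrib]
      exact Finset.sum_congr rfl fun k _ => by noncomm_ring
    rw [h9, ← hBB, Finset.smul_sum, ← Finset.sum_sub_distrib]
    nth_rewrite 1 [hWB]
    rw [Finset.sum_mul]
    refine Finset.sum_congr rfl fun k _ => ?_
    have := hanti k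
    have h10 : e k * W = (-6 : ℝ) • B k - W * e k := eq_sub_of_add_eq this
    rw [mul_assoc, h10, mul_sub, mul_smul_comm, ← mul_assoc]
  have h11 := he.quad_cyc_eq (R := R)
    (fun i j k l => by
      simp only [hR, ← Finset.sum_neg_distrib]
      exact Finset.sum_congr rfl fun a _ => by rw [h1 i j a]; ring)
    (fun i j k l => Finset.sum_congr rfl fun a _ => mul_comm _ _)
  have h12 : ∑ i, ∑ j, R i j i j = ∑ i, ∑ j, ∑ k, T i j k ^ 2 := by
    simp only [hR, pow_two]
  rw [h12] at h11
  set s := ∑ i, ∑ j, ∑ k, T i j k ^ 2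
  have h13 : (2 : ℝ) • (W * W) =
      (2 : ℝ) • ((-3 : ℝ) • quad e (cyc R) + (6 * s) • (1 : A)) := by
    have h14 : (2 : ℝ) • (W * W) = -(6 : ℝ) • quad e R - (4 : ℝ) • quad e (cyc R) := by
      rw [two_smul]; nth_rewrite 1 [h8]; abel
    rw [h14, h11]
    module
  exact smul_right_injective A (two_ne_zero (α := ℝ)) h13

end Clifford

/-! ### Sums over increasing indices -/

section Clifford

/-- A symmetric function of four indices that vanishes on coinciding indices is summed by summing
over increasing indices. -/
theorem sum_eq_sum_increasing {n : ℕ} {V : Type*} [AddCommGroup V]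
    {F : Fin n → Fin n → Fin n → Fin n → V}
    (h12 : ∀ i j k l, F i j k l = F j i k l) (h23 : ∀ i j k l, F i j k l = F i k j l)
    (h34 : ∀ i j k l, F i j k l = F i j l k) (h0 : ∀ i j k, F i j k k = 0) :
    ∑ i, ∑ j, ∑ k, ∑ l, F i j k l =
      24 • ∑ i, ∑ j ∈ Finset.Ioi i, ∑ k ∈ Finset.Ioi j, ∑ l ∈ Finset.Ioi k, F i j k l := by
  -- `s2`, `s3` and `s4` insert one more index at a time into the increasing ones
  have hIoi : ∀ (i : Fin n) (f : Fin n → V),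
      ∑ j ∈ Finset.Ioi i, f j = ∑ j, if i < j then f j else 0 := by
    intro i f
    rw [← Finset.sum_filter]
    congr 1
    ext j; simp
  have z23 : ∀ i j l, F i j j l = 0 := fun i j l => by rw [h34, h23, h0]
  have z12 : ∀ i k l, F i i k l = 0 := fun i k l => by rw [h23, h12, z23]
  have s2 : ∑ i, ∑ j, ∑ k, ∑ l, F i j k l =
      2 • ∑ i, ∑ j, ∑ k, ∑ l, if k < l then F i j k l else 0 := by
    simp only [Finset.smul_sum]
    refine Finset.sum_congr rfl fun i _ => Finset.sum_congr rfl fun j _ => ?_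
    simp only [← Finset.smul_sum]
    have h1 : ∀ k l, F i j k l =
        (if k < l then F i j k l else 0) + if l < k then F i j k l else 0 := by
      intro k l
      rcases lt_trichotomy k l with h | h | h
      · simp [h, h.not_gt]
      · subst h; simp [h0]
      · simp [h, h.not_gt]
    have h2 : ∑ k, ∑ l, (if l < k then F i j k l else 0) =
        ∑ k, ∑ l, if k < l then F i j k l else 0 := by
      rw [Finset.sum_comm]
      exact Finset.sum_congr rfl fun k _ => Finset.sum_congr rfl fun l _ => by rw [h34]
    calc _ = ∑ k, ∑ l, ((if k < l then F i j k l else 0) + if l < k then F i j k l else 0) :=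
          Finset.sum_congr rfl fun k _ => Finset.sum_congr rfl fun l _ => h1 k l
      _ = _ := by simp only [Finset.sum_add_distrib]; rw [h2, two_smul]
  have s3 : ∑ i, ∑ j, ∑ k, ∑ l, (if k < l then F i j k l else 0) =
      3 • ∑ i, ∑ j, ∑ k, ∑ l, if j < k ∧ k < l then F i j k l else 0 := by
    simp only [Finset.smul_sum]
    refine Finset.sum_congr rfl fun i _ => ?_
    simp only [← Finset.smul_sum]
    have h1 : ∀ j k l, (if k < l then F i j k l else 0) =
        (if j < k ∧ k < l then F i j k l else 0) + (if k < j ∧ j < l then F i j k l else 0) +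
          if k < l ∧ l < j then F i j k l else 0 := by
      intro j k l
      by_cases hd : j = k ∨ j = l
      · have : F i j k l = 0 := by
          rcases hd with rfl | rfl
          · exact z23 _ _ _
          · rw [h34]; exact z23 _ _ _
        simp [this]
      · split_ifs <;> first | (exfalso; omega) | simp
    have h2 : ∑ j, ∑ k, ∑ l, (if k < j ∧ j < l then F i j k l else 0) =
        ∑ j, ∑ k, ∑ l, if j < k ∧ k < l then F i j k l else 0 := by
      rw [Finset.sum_comm]
      refine Finset.sum_congr rfl fun k _ => Finset.sum_congr rfl fun l _ =>
        Finset.sum_congr rfl fun m _ => by rw [h23]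
    have h3 : ∑ j, ∑ k, ∑ l, (if k < l ∧ l < j then F i j k l else 0) =
        ∑ j, ∑ k, ∑ l, if j < k ∧ k < l then F i j k l else 0 := by
      rw [← sum_rotate]
      rw [← sum_rotate]
      refine Finset.sum_congr rfl fun k _ => Finset.sum_congr rfl fun l _ =>
        Finset.sum_congr rfl fun m _ => by rw [h23, h34]
    simp only [h1, Finset.sum_add_distrib]
    rw [h2, h3]; abel
  have s4 : ∑ i, ∑ j, ∑ k, ∑ l, (if j < k ∧ k < l then F i j k l else 0) =
      4 • ∑ i, ∑ j, ∑ k, ∑ l, if i < j ∧ j < k ∧ k < l then F i j k l else 0 := by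
    have h1 : ∀ i j k l, (if j < k ∧ k < l then F i j k l else 0) =
        (if i < j ∧ j < k ∧ k < l then F i j k l else 0) +
        (if j < i ∧ i < k ∧ k < l then F i j k l else 0) +
        (if j < k ∧ k < i ∧ i < l then F i j k l else 0) +
          if j < k ∧ k < l ∧ l < i then F i j k l else 0 := by
      intro i j k l
      by_cases hd : i = j ∨ i = k ∨ i = l
      · have : F i j k l = 0 := by
          rcases hd with rfl | rfl | rfl
          · exact z12 _ _ _
          · rw [h23]; exact z12 _ _ _
          · rw [h34, h23]; exact z12 _ _ _
        simp [this]
      · split_ifs <;> first | (exfalso; omega) | simp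
    have h2 : ∑ i, ∑ j, ∑ k, ∑ l, (if j < i ∧ i < k ∧ k < l then F i j k l else 0) =
        ∑ i, ∑ j, ∑ k, ∑ l, if i < j ∧ j < k ∧ k < l then F i j k l else 0 := by
      rw [Finset.sum_comm]
      exact Finset.sum_congr rfl fun i _ => Finset.sum_congr rfl fun j _ =>
        Finset.sum_congr rfl fun k _ => Finset.sum_congr rfl fun l _ => by rw [h12]
    have h3 : ∑ i, ∑ j, ∑ k, ∑ l, (if j < k ∧ k < i ∧ i < l then F i j k l else 0) =
        ∑ i, ∑ j, ∑ k, ∑ l, if i < j ∧ j < k ∧ k < l then F i j k l else 0 := by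
      rw [← sum_rotate]
      rw [← sum_rotate]
      exact Finset.sum_congr rfl fun i _ => Finset.sum_congr rfl fun j _ =>
        Finset.sum_congr rfl fun k _ => Finset.sum_congr rfl fun l _ => by rw [h12, h23]
    have h4 : ∑ i, ∑ j, ∑ k, ∑ l, (if j < k ∧ k < l ∧ l < i then F i j k l else 0) =
        ∑ i, ∑ j, ∑ k, ∑ l, if i < j ∧ j < k ∧ k < l then F i j k l else 0 := by
      calc _ = ∑ j, ∑ i, ∑ k, ∑ l, (if j < k ∧ k < l ∧ l < i then F i j k l else 0) :=
            Finset.sum_comm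
        _ = ∑ j, ∑ k, ∑ i, ∑ l, (if j < k ∧ k < l ∧ l < i then F i j k l else 0) :=
            Finset.sum_congr rfl fun _ _ => Finset.sum_comm
        _ = ∑ j, ∑ k, ∑ l, ∑ i, (if j < k ∧ k < l ∧ l < i then F i j k l else 0) :=
            Finset.sum_congr rfl fun _ _ => Finset.sum_congr rfl fun _ _ => Finset.sum_comm
        _ = _ := Finset.sum_congr rfl fun i _ => Finset.sum_congr rfl fun j _ =>
          Finset.sum_congr rfl fun k _ => Finset.sum_congr rfl fun l _ => by rw [h12, h23, h34]
    simp only [h1, Finset.sum_add_distrib]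
    rw [h2, h3, h4]; abel
  have s5 : ∑ i, ∑ j ∈ Finset.Ioi i, ∑ k ∈ Finset.Ioi j, ∑ l ∈ Finset.Ioi k, F i j k l =
      ∑ i, ∑ j, ∑ k, ∑ l, if i < j ∧ j < k ∧ k < l then F i j k l else 0 := by
    simp only [hIoi]
    refine Finset.sum_congr rfl fun i _ => Finset.sum_congr rfl fun j _ => ?_
    by_cases h : i < j
    · simp only [h, if_true, true_and]
      refine Finset.sum_congr rfl fun k _ => ?_
      by_cases h' : j < k <;> simp [h']
    · simp [h]
  rw [s2, s3, s4, s5, smul_smul, smul_smul]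
  rfl

end Clifford

/-! ### Velocities of one-parameter groups in finite dimensional algebras -/

section OneParameter
open Filter Topology

/-- A continuous one-parameter group in a Banach algebra is differentiable: multiplied by the
invertible element `∫ s in 0..ε, β s`, it becomes a primitive of a continuous function. -/
theorem exists_hasDerivAt_of_continuous_hom {A : Type*} [NormedRing A] [NormedAlgebra ℝ A]
    [CompleteSpace A] {β : ℝ → A} (hβ : Continuous β) (h0 : β 0 = 1)
    (hadd : ∀ s t, β (s + t) = β s * β t) : ∃ x, HasDerivAt β x 0 := by
  have hF : ∀ t, HasDerivAt (fun t => ∫ s in (0 : ℝ)..t, β s) (β t) t := fun t =>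
    intervalIntegral.integral_hasDerivAt_right (hβ.intervalIntegrable _ _)
      (hβ.stronglyMeasurableAtFilter _ _) hβ.continuousAt
  obtain ⟨ε, hε⟩ : ∃ ε : ℝ, IsUnit (∫ s in (0 : ℝ)..ε, β s) := by
    have h1 := (hF 0).tendsto_slope_zero
    rw [h0] at h1
    have h2 := h1.eventually (Units.isOpen.mem_nhds (isUnit_one (M := A)))
    obtain ⟨ε, hu, hne⟩ := (h2.and self_mem_nhdsWithin).exists
    refine ⟨ε, ?_⟩
    simp only [zero_add, intervalIntegral.integral_same, sub_zero] at hu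
    have h3 : (∫ s in (0 : ℝ)..ε, β s) = algebraMap ℝ A ε * (ε⁻¹ • ∫ s in (0 : ℝ)..ε, β s) := by
      rw [← Algebra.smul_def, smul_smul, mul_inv_cancel₀ hne, one_smul]
    rw [h3]
    exact ((isUnit_iff_ne_zero.2 hne).map (algebraMap ℝ A)).mul hu
  obtain ⟨u, hu⟩ := hε
  have h1 : ∀ t, β t = ((∫ s in (0 : ℝ)..(t + ε), β s) - ∫ s in (0 : ℝ)..t, β s) * (u⁻¹ : Aˣ) := by
    intro t
    rw [intervalIntegral.integral_interval_sub_left (hβ.intervalIntegrable _ _)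
      (hβ.intervalIntegrable _ _)]
    have h2 : ∫ s in t..(t + ε), β s = β t * u := by
      have h3 := (ContinuousLinearMap.mul ℝ A (β t)).intervalIntegral_comp_comm
        (hβ.intervalIntegrable (μ := MeasureTheory.volume) 0 ε)
      simp only [ContinuousLinearMap.mul_apply', ← hadd] at h3
      rw [hu, ← h3, intervalIntegral.integral_comp_add_left (fun s => β s) t, add_zero]
    rw [h2, Units.mul_inv_cancel_right]
  have h2 : HasDerivAt (fun t => ((∫ s in (0 : ℝ)..(t + ε), β s) - ∫ s in (0 : ℝ)..t, β s) *
      (u⁻¹ : Aˣ)) _ 0 :=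
    (((hF (0 + ε)).comp_add_const 0 ε).sub (hF 0)).mul_const _
  exact ⟨_, h2.congr_of_eventuallyEq (Eventually.of_forall h1)⟩

theorem hasDerivAt_comp_neg_zero {V : Type*} [NormedAddCommGroup V] [NormedSpace ℝ V] {f : ℝ → V}
    {f' : V} (h : HasDerivAt f f' 0) : HasDerivAt (fun s => f (-s)) (-f') 0 := by
  rw [← neg_zero] at h
  simpa [Function.comp_def] using h.scomp (0 : ℝ) (hasDerivAt_neg (0 : ℝ))

variable {A : Type*} [Ring A] [Algebra ℝ A]

/-- `x` is the derivative of `β` at `0` in the finite dimensional real algebra `A`, tested by linear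
functionals. -/
def HasVelocity (β : ℝ → A) (x : A) : Prop :=
  ∀ f : A →ₗ[ℝ] ℝ, HasDerivAt (fun s => f (β s)) (f x) 0

variable [FiniteDimensional ℝ A]

/-- A continuous one-parameter group in a finite dimensional algebra, which carries no norm, has a
velocity. -/
theorem exists_hasVelocity {β : ℝ → A} (hβ : ∀ f : A →ₗ[ℝ] ℝ, Continuous fun s => f (β s))
    (h0 : β 0 = 1) (hadd : ∀ s t, β (s + t) = β s * β t) : ∃ x, HasVelocity β x := by
  -- the regular representation maps the one-parameter group to a Banach algebra
  let b := Module.finBasis ℝ A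
  let φ := b.equivFun
  let S := Fin (Module.finrank ℝ A) → ℝ
  let B : ℝ → S →L[ℝ] S := fun s =>
    LinearMap.toContinuousLinearMap (φ.toLinearMap ∘ₗ LinearMap.mulLeft ℝ (β s) ∘ₗ φ.symm.toLinearMap)
  have hB : ∀ s v, B s v = φ (β s * φ.symm v) := fun s v => rfl
  have hBc : Continuous B := by
    rw [continuous_clm_apply]
    intro v
    refine continuous_pi fun i => ?_
    exact hβ (LinearMap.proj i ∘ₗ φ.toLinearMap ∘ₗ LinearMap.mulRight ℝ (φ.symm v))
  obtain ⟨B', hB'⟩ := exists_hasDerivAt_of_continuous_hom hBc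
    (by ext v; simp [hB, h0]) (fun s t => by ext v; simp [hB, hadd, mul_assoc])
  refine ⟨φ.symm (B' (φ 1)), fun f => ?_⟩
  let f' : S →L[ℝ] ℝ := LinearMap.toContinuousLinearMap (f ∘ₗ φ.symm.toLinearMap)
  have h1 := f'.hasFDerivAt.comp_hasDerivAt 0 (hB'.clm_apply (hasDerivAt_const 0 (φ 1)))
  have h2 : ∀ s, f' (B s (φ 1)) = f (β s) := fun s => by simp [f', hB]
  have h3 : f' (B' (φ 1)) = f (φ.symm (B' (φ 1))) := rfl
  simp only [Function.comp_def, h2, map_zero, add_zero, h3] at h1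
  exact h1

variable {V : Type*} [NormedAddCommGroup V] [NormedSpace ℝ V] {β α : ℝ → A} {x y : A}

theorem HasVelocity.linear (h : HasVelocity β x) (L : A →ₗ[ℝ] V) :
    HasDerivAt (fun s => L (β s)) (L x) 0 := by
  let b := Module.finBasis ℝ A
  have hL : ∀ a, L a = ∑ i, b.coord i a • L (b i) := fun a => by
    conv_lhs => rw [← b.sum_repr a, map_sum]
    exact Finset.sum_congr rfl fun i _ => by rw [map_smul, b.coord_apply]
  rw [show (fun s => L (β s)) = _ from funext fun s => hL (β s), hL x]
  exact HasDerivAt.fun_sum fun i _ => (h (b.coord i)).smul_const _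

theorem HasVelocity.bilinear (hβ : HasVelocity β x) (hα : HasVelocity α y)
    (L : A →ₗ[ℝ] A →ₗ[ℝ] V) :
    HasDerivAt (fun s => L (β s) (α s)) (L x (α 0) + L (β 0) y) 0 := by
  let b := Module.finBasis ℝ A
  have hL : ∀ a c, L a c = ∑ i, b.coord i a • L (b i) c := fun a c => by
    conv_lhs => rw [← b.sum_repr a, map_sum, LinearMap.sum_apply]
    exact Finset.sum_congr rfl fun i _ => by rw [map_smul, LinearMap.smul_apply, b.coord_apply]
  rw [show (fun s => L (β s) (α s)) = _ from funext fun s => hL (β s) (α s), hL x, hL (β 0),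
    ← Finset.sum_add_distrib]
  exact HasDerivAt.fun_sum fun i _ =>
    ((hβ (b.coord i)).smul (hα.linear (L (b i)))).congr_deriv (add_comm _ _)

theorem HasVelocity.unique (h : HasVelocity β x) (h' : HasVelocity β y) : x = y := by
  let b := Module.finBasis ℝ A
  exact b.ext_elem fun i => (h (b.coord i)).unique (h' (b.coord i))

end OneParameter

/-! ### Lifting skew symmetric endomorphisms to the Clifford algebra -/

section SpinRep
open CliffordAlgebra
variable {E : Type*} [NormedAddCommGroup E] [NormedSpace ℝ E]
  {G : Type*} [TopologicalSpace G] [ChartedSpace E G] [Group G] {H : Subgroup G}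
  (M : Space E H)

namespace Space
theorem inc_mul_add_swap (v w : M.𝔪) :
    M.inc v * M.inc w + M.inc w * M.inc v = algebraMap ℝ M.Cl (-2 * M.metric v w) := by
  rw [ι_mul_ι_add_swap]
  congr 1
  simp only [form, QuadraticMap.polar, neg_apply, LinearMap.BilinMap.toQuadraticMap_apply,
    map_add, LinearMap.add_apply]
  rw [M.symm w v]; ring

/-- The basis `Z` of `𝔪` is orthonormal. -/
def IsOrthonormal {n : ℕ} (Z : Module.Basis (Fin n) ℝ M.𝔪) : Prop :=
  ∀ i j, M.metric (Z i) (Z j) = if i = j then 1 else 0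

variable {M} {n : ℕ} {Z : Module.Basis (Fin n) ℝ M.𝔪}

theorem IsOrthonormal.isCliffordFrame (hZ : M.IsOrthonormal Z) :
    IsCliffordFrame fun i => M.inc (Z i) := by
  intro i j
  rw [inc_mul_add_swap, hZ]
  split_ifs
  · rw [mul_one, map_neg, map_ofNat]
  · rw [mul_zero, map_zero]

theorem adjoin_range_inc_basis (Z : Module.Basis (Fin n) ℝ M.𝔪) :
    Algebra.adjoin ℝ (Set.range fun i => M.inc (Z i)) = ⊤ := by
  rw [eq_top_iff, ← adjoin_range_ι, Algebra.adjoin_le_iff]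
  rintro _ ⟨v, rfl⟩
  rw [← Z.sum_repr v, map_sum]
  refine Subalgebra.sum_mem _ fun i _ => ?_
  rw [map_smul]
  exact Subalgebra.smul_mem _ (Algebra.subset_adjoin (Set.mem_range_self i)) _

theorem IsOrthonormal.finiteDimensional_Cl (hZ : M.IsOrthonormal Z) :
    FiniteDimensional ℝ M.Cl :=
  hZ.isCliffordFrame.finiteDimensional (adjoin_range_inc_basis Z)

theorem IsOrthonormal.sum_metric_smul (hZ : M.IsOrthonormal Z) (v : M.𝔪) :
    ∑ i, M.metric v (Z i) • Z i = v := by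
  conv_rhs => rw [← Z.sum_repr v]
  refine Finset.sum_congr rfl fun i _ => ?_
  congr 1
  conv_lhs => rw [← Z.sum_repr v, map_sum, LinearMap.sum_apply]
  simp only [map_smul, LinearMap.smul_apply, hZ _ _, smul_eq_mul, mul_ite, mul_one, mul_zero,
    Finset.sum_ite_eq', Finset.mem_univ, if_true]

theorem IsOrthonormal.metric_eq_sum (hZ : M.IsOrthonormal Z) (v w : M.𝔪) :
    M.metric v w = ∑ i, M.metric v (Z i) * M.metric w (Z i) := by
  conv_lhs => rw [← hZ.sum_metric_smul w]
  simp [mul_comm]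

theorem involute_eq_of_mem_spin {x : M.Cl} (hx : x ∈ M.spin) : involute x = x := by
  induction hx using Submodule.span_induction with
  | mem x hx => obtain ⟨v, w, -, rfl⟩ := hx; simp
  | zero => simp
  | add x y _ _ hx hy => rw [map_add, hx, hy]
  | smul a x _ hx => rw [map_smul, hx]

theorem reverse_eq_neg_of_mem_spin {x : M.Cl} (hx : x ∈ M.spin) : reverse x = -x := by
  induction hx using Submodule.span_induction with
  | mem x hx =>
    obtain ⟨v, w, h, rfl⟩ := hx
    rw [reverse.map_mul, reverse_ι, reverse_ι]
    have := inc_mul_add_swap M w v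
    rw [M.symm, h, mul_zero, map_zero] at this
    exact eq_neg_of_add_eq_zero_left this
  | zero => simp
  | add x y _ _ hx hy => rw [map_add, hx, hy]; abel
  | smul a x _ hx => rw [map_smul, hx, smul_neg]

/-- An even element of the Clifford algebra that is negated by the reversal is determined by its
commutators with vectors: the difference of two of them is a scalar, and negated by the reversal. -/
theorem IsOrthonormal.eq_of_commutator_eq (hZ : M.IsOrthonormal Z) {x y : M.Cl}
    (hx : involute x = x) (hx' : reverse x = -x) (hy : involute y = y) (hy' : reverse y = -y)
    (h : ∀ v, x * M.inc v - M.inc v * x = y * M.inc v - M.inc v * y) : x = y := by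
  obtain ⟨r, hr⟩ := hZ.isCliffordFrame.mem_range_of_commute (adjoin_range_inc_basis Z) involute
    (fun i => involute_ι _) (z := x - y) (by rw [map_sub, hx, hy]) (fun i => by
      have := h (Z i)
      rw [mul_sub, sub_mul, sub_eq_sub_iff_add_eq_add]
      rw [sub_eq_sub_iff_add_eq_add] at this
      rw [add_comm, ← this, add_comm])
  have h1 : reverse (x - y) = -(x - y) := by rw [map_sub, hx', hy']; abel
  have h2 : reverse (x - y) = x - y := by rw [hr, reverse.commutes]
  have h3 : (2 : ℝ) • (x - y) = 0 := by
    rw [two_smul]; nth_rewrite 1 [← h2]; rw [h1, neg_add_cancel]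
  exact sub_eq_zero.1 ((smul_eq_zero.1 h3).resolve_left two_ne_zero)

/-- The bivector `¼ ∑ ⟨A Z_i, Z_j⟩ Z_i · Z_j` of an endomorphism `A` of `𝔪`. -/
def bivector (Z : Module.Basis (Fin n) ℝ M.𝔪) (A : M.𝔪 → M.𝔪) : M.Cl :=
  (1 / 4 : ℝ) • ∑ i, ∑ j, M.metric (A (Z i)) (Z j) • (M.inc (Z i) * M.inc (Z j))

variable {A : M.𝔪 → M.𝔪}

theorem metric_skew (hA : ∀ v w, M.metric (A v) w + M.metric v (A w) = 0) (v w : M.𝔪) :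
    M.metric (A v) w = -M.metric (A w) v := by
  rw [eq_neg_iff_add_eq_zero, M.symm (A w)]; exact hA _ _

theorem IsOrthonormal.bivector_mem_spin (hZ : M.IsOrthonormal Z)
    (hA : ∀ v w, M.metric (A v) w + M.metric v (A w) = 0) : bivector Z A ∈ M.spin := by
  refine Submodule.smul_mem _ _ (Submodule.sum_mem _ fun i _ => Submodule.sum_mem _ fun j _ => ?_)
  by_cases hij : i = j
  · subst hij
    have h0 : M.metric (A (Z i)) (Z i) = 0 := by linarith [metric_skew hA (Z i) (Z i)]
    rw [h0, zero_smul]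
    exact Submodule.zero_mem _
  · exact Submodule.smul_mem _ _ (Submodule.subset_span ⟨_, _, by rw [hZ, if_neg hij], rfl⟩)

theorem IsOrthonormal.bivector_commutator (hZ : M.IsOrthonormal Z)
    (hlin : IsLinearMap ℝ A) (hA : ∀ v w, M.metric (A v) w + M.metric v (A w) = 0) (v : M.𝔪) :
    bivector Z A * M.inc v - M.inc v * bivector Z A = M.inc (A v) := by
  have hb : ∀ k, bivector Z A * M.inc (Z k) - M.inc (Z k) * bivector Z A = M.inc (A (Z k)) := by
    intro k
    have h := hZ.isCliffordFrame.commutator_sum (fun i j => metric_skew hA (Z i) (Z j)) k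
    rw [bivector, smul_mul_assoc, mul_smul_comm, ← smul_sub, h, smul_smul]
    conv_rhs => rw [← hZ.sum_metric_smul (A (Z k)), map_sum]
    norm_num
  have hl : LinearMap.mulLeft ℝ (bivector Z A) ∘ₗ M.inc -
      LinearMap.mulRight ℝ (bivector Z A) ∘ₗ M.inc = M.inc ∘ₗ hlin.mk' A := Z.ext hb
  exact congrArg (fun L : M.𝔪 →ₗ[ℝ] M.Cl => L v) hl

/-- The lift of a skew symmetric endomorphism to `𝔰𝔭𝔦𝔫(𝔪)` is its bivector. -/
theorem IsOrthonormal.spinLift_eq (hZ : M.IsOrthonormal Z) (hlin : IsLinearMap ℝ A)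
    (hA : ∀ v w, M.metric (A v) w + M.metric v (A w) = 0) : M.spinLift A = bivector Z A := by
  have hex : ∃ x ∈ M.spin, ∀ v, x * M.inc v - M.inc v * x = M.inc (A v) :=
    ⟨_, hZ.bivector_mem_spin hA, hZ.bivector_commutator hlin hA⟩
  rw [spinLift, dif_pos hex]
  obtain ⟨h1, h2⟩ := hex.choose_spec
  have hmem := hZ.bivector_mem_spin hA
  exact hZ.eq_of_commutator_eq (involute_eq_of_mem_spin h1) (reverse_eq_neg_of_mem_spin h1)
    (involute_eq_of_mem_spin hmem) (reverse_eq_neg_of_mem_spin hmem)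
    fun v => (h2 v).trans (hZ.bivector_commutator hlin hA v).symm

end Space
end SpinRep

/-! ### The isotropy representation on spinors -/

section Isotropy

theorem map_zero_of_map_add {G : Type*} [Group G] {γ : ℝ → G}
    (hadd : ∀ s t, γ (s + t) = γ s * γ t) : γ 0 = 1 := by
  have := hadd 0 0
  rw [add_zero] at this
  exact mul_eq_left.1 this.symm

theorem map_neg_of_map_add {G : Type*} [Group G] {γ : ℝ → G}
    (hadd : ∀ s t, γ (s + t) = γ s * γ t) (s : ℝ) : γ (-s) = (γ s)⁻¹ :=
  eq_inv_of_mul_eq_one_left (by rw [← hadd, neg_add_cancel, map_zero_of_map_add hadd])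

open CliffordAlgebra
variable {E : Type*} [NormedAddCommGroup E] [NormedSpace ℝ E]
  {G : Type*} [TopologicalSpace G] [ChartedSpace E G] [Group G]

theorem bracket_swap (U V : GroupLieAlgebra 𝓘(ℝ, E) G) : ⁅U, V⁆ = -⁅V, U⁆ :=
  VectorField.mlieBracket_swap_apply

namespace Space
variable {H : Subgroup G} {M : Space E H}

theorem prM_add_prH (U : GroupLieAlgebra 𝓘(ℝ, E) G) :
    (M.prM U : GroupLieAlgebra 𝓘(ℝ, E) G) + (M.prH U : GroupLieAlgebra 𝓘(ℝ, E) G) = U :=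
  Submodule.projection_add_projection_eq_self M.isCompl U

theorem prM_coe (U : M.𝔪) : M.prM U = U := Submodule.projectionOnto_apply_left M.isCompl U

theorem metric_brM_swap (X Y W : M.𝔪) : M.metric (M.brM X Y) W = -M.metric (M.brM Y X) W := by
  rw [brM, br, bracket_swap, map_neg, map_neg, LinearMap.neg_apply]; rfl

theorem metric_brM_swap_right (X Y W : M.𝔪) :
    M.metric (M.brM X Y) W = -M.metric (M.brM X W) Y := by
  rw [M.symm (M.brM X W)]
  exact eq_neg_of_add_eq_zero_left (M.naturally_reductive X Y W)

variable {Q : LinearMap.BilinForm ℝ (GroupLieAlgebra 𝓘(ℝ, E) G)}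

theorem IsInvariantExtension.metric_prM (hQ : M.IsInvariantExtension Q)
    (U : GroupLieAlgebra 𝓘(ℝ, E) G) (Y : M.𝔪) : M.metric (M.prM U) Y = Q U Y := by
  conv_rhs => rw [← prM_add_prH (M := M) U]
  rw [map_add, LinearMap.add_apply, hQ.orthogonal, add_zero, hQ.extends_metric]

theorem IsInvariantExtension.prH_apply (hQ : M.IsInvariantExtension Q)
    (U : GroupLieAlgebra 𝓘(ℝ, E) G) (X : lieAlg E H) : Q (M.prH U) X = Q U X := by
  conv_rhs => rw [← prM_add_prH (M := M) U]
  rw [map_add, LinearMap.add_apply, hQ.symm (M.prM U), hQ.orthogonal, zero_add]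

variable [FiniteDimensional ℝ E] [LieGroup 𝓘(ℝ, E) ∞ G]

variable (E G) in
/-- The Lie bracket of the Lie algebra of `G` as a bilinear map. -/
def bracket : GroupLieAlgebra 𝓘(ℝ, E) G →ₗ[ℝ] GroupLieAlgebra 𝓘(ℝ, E) G →ₗ[ℝ]
    GroupLieAlgebra 𝓘(ℝ, E) G :=
  haveI : CompleteSpace E := FiniteDimensional.complete ℝ E
  haveI : LieGroup 𝓘(ℝ, E) (minSmoothness ℝ 3) G := by
    rw [minSmoothness_of_isRCLikeNormedField]
    exact LieGroup.of_le (n := ∞) ENat.LEInfty.out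
  LinearMap.mk₂ ℝ (fun U V => ⁅U, V⁆) add_lie smul_lie lie_add lie_smul

theorem IsInvariantExtension.bracket_skew (hQ : M.IsInvariantExtension Q)
    (W U V : GroupLieAlgebra 𝓘(ℝ, E) G) : Q ⁅W, U⁆ V = -Q U ⁅W, V⁆ :=
  eq_neg_of_add_eq_zero_left (bracket_invariant_of_Ad_invariant Q hQ.invariant W U V)

theorem isLinearMap_adH (X : lieAlg E H) : IsLinearMap ℝ (M.adH X) :=
  (M.prM ∘ₗ bracket E G X ∘ₗ M.𝔪.subtype).isLinear

theorem IsInvariantExtension.adH_skew (hQ : M.IsInvariantExtension Q) (X : lieAlg E H)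
    (v w : M.𝔪) : M.metric (M.adH X v) w + M.metric v (M.adH X w) = 0 := by
  rw [adH, adH, M.symm v, hQ.metric_prM, hQ.metric_prM, hQ.bracket_skew, hQ.symm v, neg_add_cancel]

variable {n : ℕ} {Z : Module.Basis (Fin n) ℝ M.𝔪}

theorem isLinearMap_Lam (t : ℝ) (X : M.𝔪) : IsLinearMap ℝ (M.Lam t X) :=
  (t • M.prM ∘ₗ bracket E G X ∘ₗ M.𝔪.subtype).isLinear

theorem IsOrthonormal.spinLift_Lam (hZ : M.IsOrthonormal Z) (t : ℝ) (X : M.𝔪) :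
    M.spinLift (M.Lam t X) = (t / 4) • ∑ i, ∑ j, M.metric (M.brM X (Z i)) (Z j) •
      (M.inc (Z i) * M.inc (Z j)) := by
  rw [hZ.spinLift_eq (isLinearMap_Lam t X) fun v w => by
    simp only [Lam]
    rw [map_smul, map_smul, LinearMap.smul_apply, M.symm v, metric_brM_swap_right, smul_neg,
      neg_add_cancel]]
  simp only [bivector, Lam, map_smul, LinearMap.smul_apply, smul_eq_mul, Finset.smul_sum, smul_smul]
  refine Finset.sum_congr rfl fun i _ => Finset.sum_congr rfl fun j _ => ?_
  congr 1; ring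

/-- For `U ∈ 𝔥` this is the lift `ãd(U)`; the formula makes sense, and is linear, on all of the Lie
algebra. -/
def adBivector (Q : LinearMap.BilinForm ℝ (GroupLieAlgebra 𝓘(ℝ, E) G))
    (Z : Module.Basis (Fin n) ℝ M.𝔪) : GroupLieAlgebra 𝓘(ℝ, E) G →ₗ[ℝ] M.Cl :=
  (1 / 4 : ℝ) • ∑ i, ∑ j, LinearMap.toSpanSingleton ℝ M.Cl (M.inc (Z i) * M.inc (Z j)) ∘ₗ
    Q.flip (Z j) ∘ₗ (bracket E G).flip (Z i)

theorem adBivector_apply (U : GroupLieAlgebra 𝓘(ℝ, E) G) : adBivector Q Z U =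
    (1 / 4 : ℝ) • ∑ i, ∑ j, Q ⁅U, (Z i : GroupLieAlgebra 𝓘(ℝ, E) G)⁆ (Z j) •
      (M.inc (Z i) * M.inc (Z j)) := by
  simp only [adBivector, LinearMap.smul_apply, LinearMap.sum_apply]
  rfl

theorem IsInvariantExtension.adBivector_coe (hQ : M.IsInvariantExtension Q) (X : lieAlg E H) :
    adBivector Q Z X = bivector Z (M.adH X) := by
  rw [adBivector_apply]
  simp only [← hQ.metric_prM]
  rfl

theorem IsInvariantExtension.adLift_eq (hQ : M.IsInvariantExtension Q) (hZ : M.IsOrthonormal Z)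
    (X : lieAlg E H) : M.adLift X = adBivector Q Z X := by
  rw [hQ.adBivector_coe]
  exact hZ.spinLift_eq (isLinearMap_adH X) (hQ.adH_skew X)

variable {Δ : Type*} [NormedAddCommGroup Δ] [NormedSpace ℂ Δ]
  {c : M.Cl →ₐ[ℝ] Module.End ℂ Δ} {σ : M.SpinStructure} {ψ : G → Δ}

/-- The lift of a one-parameter group of `H` to `Spin(𝔪)` has the velocity `ãd(X)`: like the
elements of `𝔰𝔭𝔦𝔫(𝔪)`, the velocity of the lift is even and negated by the reversal, and it has the
commutators of `ãd(X)` with vectors, because the lift covers `Ad`. -/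
theorem hasVelocity_lift (hQ : M.IsInvariantExtension Q) (hZ : M.IsOrthonormal Z)
    (σ : M.SpinStructure) {γ : ℝ → G} (hγ : ContMDiff 𝓘(ℝ, ℝ) 𝓘(ℝ, E) ∞ γ)
    (hadd : ∀ s t, γ (s + t) = γ s * γ t) (hmem : ∀ s, γ s ∈ H) {X : lieAlg E H}
    (hX : (mfderiv 𝓘(ℝ, ℝ) 𝓘(ℝ, E) γ 0 : ℝ →L[ℝ] E) 1 = (X : GroupLieAlgebra 𝓘(ℝ, E) G)) :
    HasVelocity (fun s => (σ.lift ⟨γ s, hmem s⟩ : M.Cl)) (adBivector Q Z X) := by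
  have := hZ.finiteDimensional_Cl
  have h1 : γ 0 = 1 := map_zero_of_map_add hadd
  have h0 : (σ.lift ⟨γ 0, hmem 0⟩ : M.Cl) = 1 := by
    have : (⟨γ 0, hmem 0⟩ : H) = 1 := Subtype.ext h1
    rw [this, map_one]; rfl
  have hhom : ∀ s t, (σ.lift ⟨γ (s + t), hmem (s + t)⟩ : M.Cl) =
      σ.lift ⟨γ s, hmem s⟩ * σ.lift ⟨γ t, hmem t⟩ := fun s t => by
    have : (⟨γ (s + t), hmem (s + t)⟩ : H) = ⟨γ s, hmem s⟩ * ⟨γ t, hmem t⟩ :=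
      Subtype.ext (hadd s t)
    rw [this, map_mul]; rfl
  obtain ⟨x, hx⟩ := exists_hasVelocity (β := fun s => (σ.lift ⟨γ s, hmem s⟩ : M.Cl))
    (fun f => (σ.continuous f).comp (hγ.continuous.subtype_mk hmem)) h0 hhom
  -- the lift is even, its reversal is its inverse, and it covers `Ad`
  have hinv : involute x = x := by
    have h : HasVelocity (fun s => (σ.lift ⟨γ s, hmem s⟩ : M.Cl)) (involute x) := fun f => by
      refine (hx (f ∘ₗ involute.toLinearMap)).congr_of_eventuallyEq (.of_forall fun s => ?_)
      exact congrArg f (spinGroup.involute_eq (σ.lift ⟨γ s, hmem s⟩).2).symm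
    exact h.unique hx
  have hneg : ∀ s, reverse (σ.lift ⟨γ s, hmem s⟩ : M.Cl) = σ.lift ⟨γ (-s), hmem (-s)⟩ := by
    intro s
    have h2 : (⟨γ (-s), hmem (-s)⟩ : H) = (⟨γ s, hmem s⟩ : H)⁻¹ :=
      Subtype.ext (map_neg_of_map_add hadd s)
    rw [h2, map_inv, ← spinGroup.star_eq_inv, spinGroup.coe_star, star_def,
      spinGroup.involute_eq (σ.lift ⟨γ s, hmem s⟩).2]
  have hrev : reverse x = -x := by
    have h : HasVelocity (fun s => (σ.lift ⟨γ (-s), hmem (-s)⟩ : M.Cl)) (reverse x) := fun f => by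
      refine (hx (f ∘ₗ reverse)).congr_of_eventuallyEq (.of_forall fun s => ?_)
      exact congrArg f (hneg s).symm
    have h' : HasVelocity (fun s => (σ.lift ⟨γ (-s), hmem (-s)⟩ : M.Cl)) (-x) := fun f => by
      rw [map_neg]
      exact hasDerivAt_comp_neg_zero (hx f)
    exact h.unique h'
  have hcomm : ∀ v, x * M.inc v - M.inc v * x = M.inc (M.adH X v) := by
    intro v
    have hα : HasVelocity (fun s => M.inc (M.prM (Ad (E := E) (γ s) v))) (M.inc (M.adH X v)) :=
      fun f => hasDerivAt_Ad_curve (hγ.mdifferentiable (by simp) 0) h1 hX v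
        (f ∘ₗ M.inc ∘ₗ M.prM)
    have hl : HasVelocity (fun s => (σ.lift ⟨γ s, hmem s⟩ : M.Cl) * M.inc v) (x * M.inc v) :=
      fun f => hx (f ∘ₗ LinearMap.mulRight ℝ (M.inc v))
    have hr : HasVelocity (fun s => (σ.lift ⟨γ s, hmem s⟩ : M.Cl) * M.inc v)
        (M.inc (M.adH X v) + M.inc v * x) := fun f => by
      have h := hα.bilinear hx ((LinearMap.mul ℝ M.Cl).compr₂ f)
      simp only [LinearMap.compr₂_apply, LinearMap.mul_apply', ← map_add] at h
      rw [h0, h1, Ad_one, prM_coe, mul_one] at h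
      refine h.congr_of_eventuallyEq (.of_forall fun s => congrArg f ?_)
      have hc := σ.covers ⟨γ s, hmem s⟩ v
      have h5 : M.prM (Ad (E := E) (γ s) v) = ⟨Ad (γ s) v, M.Ad_mem _ (hmem s) v v.2⟩ :=
        prM_coe (M := M) ⟨Ad (γ s) v, M.Ad_mem _ (hmem s) v v.2⟩
      have h6 : (((σ.lift ⟨γ s, hmem s⟩)⁻¹ : spinGroup M.form) : M.Cl) *
          σ.lift ⟨γ s, hmem s⟩ = 1 := by
        rw [← Submonoid.coe_mul, inv_mul_cancel]; rfl
      simp only [h5]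
      rw [← hc, mul_assoc, h6, mul_one]
    rw [hl.unique hr, add_sub_cancel_right]
  have hb := hZ.bivector_mem_spin (hQ.adH_skew X)
  rw [hQ.adBivector_coe, ← hZ.eq_of_commutator_eq hinv hrev (involute_eq_of_mem_spin hb)
    (reverse_eq_neg_of_mem_spin hb) fun v => (hcomm v).trans
      (hZ.bivector_commutator (isLinearMap_adH X) (hQ.adH_skew X) v).symm]
  exact hx

/-- The derivative of a spinor field in a direction of `𝔥` is Clifford multiplication by `-ãd`: this
is the equivariance of the field, differentiated along a one-parameter group. -/
theorem IsSpinorField.leftDeriv_of_mem (hψ : M.IsSpinorField c σ ψ)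
    (hQ : M.IsInvariantExtension Q) (hZ : M.IsOrthonormal Z) {U : GroupLieAlgebra 𝓘(ℝ, E) G}
    (hU : U ∈ lieAlg E H) (g : G) : leftDeriv U ψ g = -c (adBivector Q Z U) (ψ g) := by
  have := hZ.finiteDimensional_Cl
  rw [eq_neg_iff_add_eq_zero]
  -- the value of `leftDeriv` at the zero vector
  have hz := leftDeriv_smul_left (0 : ℝ) (0 : GroupLieAlgebra 𝓘(ℝ, E) G) ψ g
  rw [zero_smul, zero_smul] at hz
  induction hU using Submodule.span_induction with
  | mem U hU =>
    obtain ⟨γ, hγ, hadd, hmem, hX⟩ := hU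
    have hU' : U ∈ lieAlg E H := Submodule.subset_span ⟨γ, hγ, hadd, hmem, hX⟩
    have h1 : γ 0 = 1 := map_zero_of_map_add hadd
    have hv := hasVelocity_lift hQ hZ σ hγ hadd hmem (X := ⟨U, hU'⟩) hX
    let L : M.Cl →ₗ[ℝ] Δ :=
      { toFun := fun a => c a (ψ g)
        map_add' := fun a b => by rw [map_add]; rfl
        map_smul' := fun r a => by rw [map_smul]; rfl }
    have hd' := hasDerivAt_comp_neg_zero (hv.linear L)
    have he : ∀ s, ψ (g * γ s) = L (σ.lift ⟨γ (-s), hmem (-s)⟩) := by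
      intro s
      have h2 : (⟨γ (-s), hmem (-s)⟩ : H) = (⟨γ s, hmem s⟩ : H)⁻¹ :=
        Subtype.ext (map_neg_of_map_add hadd s)
      rw [h2]
      exact hψ.equivariant g ⟨γ s, hmem s⟩
    have hd2 := hasDerivAt_mul_curve (hγ.mdifferentiable (by simp) 0) h1 hX hψ.smooth g
    have hd3 := (hd'.congr_of_eventuallyEq (.of_forall he)).unique hd2
    rw [← hd3]
    simp [L]
  | zero => rw [hz, map_zero, map_zero]; simp
  | add U V _ _ hU hV =>
    rw [leftDeriv_add_left, map_add, map_add, LinearMap.add_apply, add_add_add_comm, hU, hV,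
      add_zero]
  | smul a U _ hU =>
    rw [leftDeriv_smul_left, map_smul, map_smul, LinearMap.smul_apply, ← smul_add, hU, smul_zero]

end Space
end Isotropy

/-! ### The quartic and scalar terms -/

section Increasing
variable {A : Type*} [Ring A] [Algebra ℝ A] {n : ℕ} {e : Fin n → A}

/-- The cyclic part of a tensor with the symmetries of a curvature tensor, except for the Bianchi
identity, is a four form, so that its quartic sum reduces to increasing indices. -/
theorem IsCliffordFrame.quad_cyc_eq_increasing (he : IsCliffordFrame e)
    {R : Fin n → Fin n → Fin n → Fin n → ℝ} (h1 : ∀ i j k l, R i j k l = -R j i k l)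
    (h2 : ∀ i j k l, R i j k l = R k l i j) :
    quad e (cyc R) = (24 : ℝ) • ∑ i, ∑ j ∈ Finset.Ioi i, ∑ k ∈ Finset.Ioi j, ∑ l ∈ Finset.Ioi k,
      cyc R i j k l • (e i * e j * e k * e l) := by
  have h3 : ∀ i j k l, R i j k l = -R i j l k := fun i j k l => by rw [h2, h1, h2 l k]
  have c12 : ∀ i j k l, cyc R i j k l = -cyc R j i k l := fun i j k l => by
    simp only [cyc]
    rw [h1 j i k l, h1 i k j l, h1 k j i l]; ring
  have c23 : ∀ i j k l, cyc R i j k l = -cyc R i k j l := fun i j k l => by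
    simp only [cyc]
    rw [h1 i k j l, h1 k j i l, h1 j i k l]; ring
  have c34 : ∀ i j k l, cyc R i j k l = -cyc R i j l k := fun i j k l => by
    simp only [cyc]
    rw [h3 i j l k, h2 j l i k, h1 i k j l, h2 l i j k, h3 j k l i]; ring
  have hsum := sum_eq_sum_increasing (F := fun i j k l => cyc R i j k l • (e i * e j * e k * e l))
    (fun i j k l => by
      by_cases h : i = j
      · rw [h]
      · simp only [c12 i j k l, he.anticomm h, neg_mul, smul_neg, neg_smul, neg_neg])
    (fun i j k l => by
      by_cases h : j = k
      · rw [h]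
      · simp only [c23 i j k l, mul_assoc (e i), he.anticomm h, neg_mul, mul_neg, smul_neg, neg_smul,
          neg_neg])
    (fun i j k l => by
      by_cases h : k = l
      · rw [h]
      · simp only [c34 i j k l, mul_assoc (e i * e j), he.anticomm h, mul_neg, smul_neg, neg_smul,
          neg_neg])
    (fun i j k => by
      have h0 : cyc R i j k k = 0 := by linarith [c34 i j k k]
      simp only [h0, zero_smul])
  rw [quad, hsum, ← Nat.cast_smul_eq_nsmul ℝ]
  norm_num

end Increasing

section Formula
open CliffordAlgebra
namespace Space
variable {E : Type*} [NormedAddCommGroup E] [NormedSpace ℝ E]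
  {G : Type*} [TopologicalSpace G] [ChartedSpace E G] [Group G]
  {H : Subgroup G} {M : Space E H} {n : ℕ} {Z : Module.Basis (Fin n) ℝ M.𝔪}

/-- The components `⟨[Z_i, Z_j]_𝔪, Z_k⟩` of the torsion three form. -/
def torsion (Z : Module.Basis (Fin n) ℝ M.𝔪) (i j k : Fin n) : ℝ :=
  M.metric (M.brM (Z i) (Z j)) (Z k)

/-- The Clifford cubic `∑ ⟨[Z_i, Z_j]_𝔪, Z_k⟩ Z_i · Z_j · Z_k`. -/
def cubic (Z : Module.Basis (Fin n) ℝ M.𝔪) : M.Cl :=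
  ∑ i, ∑ j, ∑ k, torsion Z i j k • (M.inc (Z i) * M.inc (Z j) * M.inc (Z k))

/-- `⟨[[Z_i, Z_j]_𝔥, Z_k], Z_l⟩`, minus the curvature of the canonical connection. -/
def curvH (Q : LinearMap.BilinForm ℝ (GroupLieAlgebra 𝓘(ℝ, E) G))
    (Z : Module.Basis (Fin n) ℝ M.𝔪) (i j k l : Fin n) : ℝ :=
  Q ⁅(M.brH (Z i) (Z j) : GroupLieAlgebra 𝓘(ℝ, E) G), (Z k : GroupLieAlgebra 𝓘(ℝ, E) G)⁆ (Z l)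

/-- `⟨[Z_i, Z_j]_𝔪, [Z_k, Z_l]_𝔪⟩`. -/
def curvM (Z : Module.Basis (Fin n) ℝ M.𝔪) (i j k l : Fin n) : ℝ :=
  ∑ a, torsion Z i j a * torsion Z k l a

theorem torsion_swap (i j k : Fin n) : torsion Z i j k = -torsion Z j i k := metric_brM_swap _ _ _

theorem torsion_swap_right (i j k : Fin n) : torsion Z i j k = -torsion Z i k j :=
  metric_brM_swap_right _ _ _

theorem curvM_swap (i j k l : Fin n) : curvM Z i j k l = -curvM Z j i k l := by
  simp only [curvM, ← Finset.sum_neg_distrib]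
  exact Finset.sum_congr rfl fun a _ => by rw [torsion_swap i j a]; ring

theorem curvM_symm (i j k l : Fin n) : curvM Z i j k l = curvM Z k l i j :=
  Finset.sum_congr rfl fun _ _ => mul_comm _ _

theorem IsOrthonormal.curvM_eq (hZ : M.IsOrthonormal Z) (i j k l : Fin n) :
    curvM Z i j k l = M.metric (M.brM (Z i) (Z j)) (M.brM (Z k) (Z l)) :=
  (hZ.metric_eq_sum _ _).symm

/-- `Jac_𝔪` gives the components of a four form. -/
theorem IsOrthonormal.metric_jacM (hZ : M.IsOrthonormal Z) (i j k l : Fin n) :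
    M.metric (Z i) (M.jacM (Z j) (Z k) (Z l)) = cyc (curvM Z) i j k l := by
  have h : ∀ a b c d, M.metric (Z a) (M.brM (Z b) (M.brM (Z c) (Z d))) = curvM Z a b c d := by
    intro a b c d
    rw [M.symm, metric_brM_swap_right, hZ.curvM_eq, metric_brM_swap (Z a)]
  simp only [jacM, map_add, h, cyc]
  rw [curvM_swap k i, curvM_symm i l j k]
  have h4 : curvM Z i k l j = -curvM Z i k j l := by
    rw [curvM_symm, curvM_swap, curvM_symm j l]
  have h5 : curvM Z j k i l = curvM Z i l j k := curvM_symm _ _ _ _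
  rw [h4]; ring

/-- In dimension at most four a term `⟨[Z_i, Z_j]_𝔪, Z_a⟩ ⟨[Z_k, Z_l]_𝔪, Z_a⟩` with distinct
`i`, `j`, `k`, `l` vanishes, since `a` is one of the four. -/
theorem curvM_eq_zero {i j k l : Fin n} (h : ∀ a, a = i ∨ a = j ∨ a = k ∨ a = l) :
    curvM Z i j k l = 0 := by
  have h0 : ∀ a b, torsion Z a b b = 0 := fun a b => by linarith [torsion_swap_right (Z := Z) a b b]
  have h0' : ∀ a b, torsion Z a b a = 0 := fun a b => by rw [torsion_swap, h0, neg_zero]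
  refine Finset.sum_eq_zero fun a _ => ?_
  rcases h a with rfl | rfl | rfl | rfl <;> simp [h0, h0']

theorem IsOrthonormal.quartic_jacM_eq_zero (hZ : M.IsOrthonormal Z) (hn : n ≤ 4) :
    M.quartic Z M.jacM = 0 := by
  refine Finset.sum_eq_zero fun i _ => Finset.sum_eq_zero fun j hj => Finset.sum_eq_zero fun k hk =>
    Finset.sum_eq_zero fun l hl => ?_
  rw [Finset.mem_Ioi] at hj hk hl
  have h : ∀ a, a = i ∨ a = j ∨ a = k ∨ a = l := fun a => by omega
  rw [hZ.metric_jacM, cyc, curvM_eq_zero h, curvM_eq_zero fun a => by have := h a; tauto,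
    curvM_eq_zero fun a => by have := h a; tauto]
  simp

theorem IsOrthonormal.quad_curvM (hZ : M.IsOrthonormal Z) :
    quad (fun i => M.inc (Z i)) (cyc (curvM Z)) = (24 : ℝ) • M.quartic Z M.jacM := by
  rw [hZ.isCliffordFrame.quad_cyc_eq_increasing curvM_swap curvM_symm]
  simp only [quartic, hZ.metric_jacM]

variable {Q : LinearMap.BilinForm ℝ (GroupLieAlgebra 𝓘(ℝ, E) G)}

theorem IsInvariantExtension.scalarM_eq (hQ : M.IsInvariantExtension Q) (hZ : M.IsOrthonormal Z) :
    M.scalarM Q Z = ∑ i, ∑ j, ∑ k, torsion Z i j k ^ 2 := by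
  refine Finset.sum_congr rfl fun i _ => Finset.sum_congr rfl fun j _ => ?_
  rw [hQ.extends_metric, hZ.metric_eq_sum]
  exact Finset.sum_congr rfl fun k _ => (pow_two _).symm

/-- The contribution of the Clifford cubic to the square of the Dirac operator: the quartic of
`Jac_𝔪` and a scalar. -/
theorem IsInvariantExtension.cubic_sq (hQ : M.IsInvariantExtension Q) (hZ : M.IsOrthonormal Z) :
    cubic Z * cubic Z = (-72 : ℝ) • M.quartic Z M.jacM + (6 * M.scalarM Q Z) • (1 : M.Cl) := by
  have h := hZ.isCliffordFrame.cubic_sq (T := torsion Z) torsion_swap torsion_swap_right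
  refine h.trans ?_
  rw [hQ.scalarM_eq hZ]
  congr 1
  have h2 := hZ.quad_curvM
  change (-3 : ℝ) • quad (fun i => M.inc (Z i)) (cyc (curvM Z)) = _
  rw [h2, smul_smul]
  norm_num

variable [FiniteDimensional ℝ E] [LieGroup 𝓘(ℝ, E) ∞ G]

theorem IsInvariantExtension.bracket_lie_apply (hQ : M.IsInvariantExtension Q)
    (U V W : GroupLieAlgebra 𝓘(ℝ, E) G) : Q ⁅U, V⁆ W = Q U ⁅V, W⁆ := by
  rw [bracket_swap, map_neg, LinearMap.neg_apply, hQ.bracket_skew, neg_neg]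

theorem IsInvariantExtension.curvH_eq (hQ : M.IsInvariantExtension Q) (i j k l : Fin n) :
    curvH Q Z i j k l = Q (M.brH (Z i) (Z j)) (M.brH (Z k) (Z l)) := by
  rw [curvH, hQ.bracket_lie_apply, hQ.symm, hQ.symm (M.brH (Z i) (Z j))]
  exact (hQ.prH_apply _ _).symm

theorem IsInvariantExtension.curvH_swap (hQ : M.IsInvariantExtension Q) (i j k l : Fin n) :
    curvH Q Z i j k l = -curvH Q Z j i k l := by
  have h : M.brH (Z i) (Z j) = -M.brH (Z j) (Z i) := by
    rw [brH, br, bracket_swap, map_neg]; rfl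
  rw [hQ.curvH_eq, hQ.curvH_eq, h, Submodule.coe_neg, map_neg, LinearMap.neg_apply]

theorem IsInvariantExtension.curvH_symm (hQ : M.IsInvariantExtension Q) (i j k l : Fin n) :
    curvH Q Z i j k l = curvH Q Z k l i j := by
  rw [hQ.curvH_eq, hQ.curvH_eq, hQ.symm]

/-- `Jac_𝔥` gives the components of a four form. -/
theorem IsInvariantExtension.metric_jacH (hQ : M.IsInvariantExtension Q) (i j k l : Fin n) :
    M.metric (Z i) (M.jacH (Z j) (Z k) (Z l)) = cyc (curvH Q Z) i j k l := by
  have h : ∀ a b c d, Q ⁅(Z b : GroupLieAlgebra 𝓘(ℝ, E) G),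
      (M.brH (Z c) (Z d) : GroupLieAlgebra 𝓘(ℝ, E) G)⁆ (Z a) = -curvH Q Z c d b a := by
    intro a b c d
    rw [bracket_swap, map_neg, LinearMap.neg_apply]; rfl
  rw [M.symm, jacH, hQ.metric_prM]
  simp only [map_add, LinearMap.add_apply, h, cyc]
  rw [hQ.curvH_symm k l j i, hQ.curvH_swap j i, hQ.curvH_swap l j, hQ.curvH_symm j l k i,
    hQ.curvH_symm j k l i, hQ.curvH_swap l i, hQ.curvH_symm i l j k]
  ring

/-- The Casimir element of `𝔥` is a quartic in the Clifford algebra. -/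
theorem IsInvariantExtension.casimirLift_eq (hQ : M.IsInvariantExtension Q)
    (hZ : M.IsOrthonormal Z) {r : ℕ} (X Y : Module.Basis (Fin r) ℝ (lieAlg E H))
    (hXY : ∀ i j, Q (X i) (Y j) = if i = j then 1 else 0) :
    M.casimirLift X Y = (-1 / 16 : ℝ) • quad (fun i => M.inc (Z i)) (curvH Q Z) := by
  -- expansion in the basis `Y`
  have hY : ∀ U : lieAlg E H, ∑ a, Q (X a) U • Y a = U := by
    intro U
    conv_rhs => rw [← Y.sum_repr U]
    refine Finset.sum_congr rfl fun a _ => ?_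
    congr 1
    conv_lhs => rw [← Y.sum_repr U, AddSubmonoidClass.coe_finsetSum, map_sum]
    simp only [Submodule.coe_smul, map_smul, hXY, smul_eq_mul, mul_ite, mul_one, mul_zero,
      Finset.sum_ite_eq, Finset.mem_univ, if_true]
  -- dual bases contract to `Q_𝔥`
  have hR : ∀ i j k l, ∑ a, Q ⁅(X a : GroupLieAlgebra 𝓘(ℝ, E) G),
      (Z i : GroupLieAlgebra 𝓘(ℝ, E) G)⁆ (Z j) * Q ⁅(Y a : GroupLieAlgebra 𝓘(ℝ, E) G),
      (Z k : GroupLieAlgebra 𝓘(ℝ, E) G)⁆ (Z l) = curvH Q Z i j k l := by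
    intro i j k l
    rw [hQ.curvH_eq]
    nth_rewrite 1 [← hY (M.brH (Z i) (Z j))]
    rw [AddSubmonoidClass.coe_finsetSum, map_sum, LinearMap.sum_apply]
    refine Finset.sum_congr rfl fun a _ => ?_
    rw [Submodule.coe_smul, map_smul, LinearMap.smul_apply, smul_eq_mul, hQ.bracket_lie_apply,
      hQ.bracket_lie_apply]
    congr 1
    · rw [hQ.symm, hQ.symm (X a)]; exact (hQ.prH_apply _ _).symm
    · rw [hQ.symm, hQ.symm (Y a)]; exact (hQ.prH_apply _ _).symm
  simp only [casimirLift, hQ.adLift_eq hZ, adBivector_apply, quad, ← hR]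
  have h3 : ∀ (f g : Fin n → Fin n → ℝ), ((1 / 4 : ℝ) • ∑ i, ∑ j, f i j •
      (M.inc (Z i) * M.inc (Z j))) * ((1 / 4 : ℝ) • ∑ i, ∑ j, g i j •
      (M.inc (Z i) * M.inc (Z j))) = (1 / 16 : ℝ) • ∑ i, ∑ j, ∑ k, ∑ l, (f i j * g k l) •
        (M.inc (Z i) * M.inc (Z j) * M.inc (Z k) * M.inc (Z l)) := by
    intro f g
    rw [smul_mul_smul_comm]
    congr 1
    · norm_num
    · simp only [Finset.sum_mul]
      refine Finset.sum_congr rfl fun i _ => Finset.sum_congr rfl fun j _ => ?_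
      simp only [Finset.mul_sum, smul_mul_smul_comm, mul_assoc]
  simp only [h3, ← Finset.smul_sum]
  rw [neg_div, neg_smul]
  congr 2
  simp only [Finset.sum_smul]
  refine Finset.sum_comm.trans (Finset.sum_congr rfl fun i _ => ?_)
  refine Finset.sum_comm.trans (Finset.sum_congr rfl fun j _ => ?_)
  refine Finset.sum_comm.trans (Finset.sum_congr rfl fun k _ => ?_)
  exact Finset.sum_comm

/-- The contribution of the curvature of `𝔥` to the square of the Dirac operator. One half of it is
the Casimir element of `𝔥`, the other half yields the quartic of `Jac_𝔥` and a scalar. -/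
theorem IsInvariantExtension.quad_curvH (hQ : M.IsInvariantExtension Q)
    (hZ : M.IsOrthonormal Z) {r : ℕ} (X Y : Module.Basis (Fin r) ℝ (lieAlg E H))
    (hXY : ∀ i j, Q (X i) (Y j) = if i = j then 1 else 0) :
    (-1 / 8 : ℝ) • quad (fun i => M.inc (Z i)) (curvH Q Z) = M.casimirLift X Y -
      (1 / 2 : ℝ) • M.quartic Z M.jacH + ((1 / 8 : ℝ) * M.scalarH Q Z) • (1 : M.Cl) := by
  have h1 := hZ.isCliffordFrame.quad_cyc_eq (hQ.curvH_swap (Z := Z)) hQ.curvH_symm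
  rw [hZ.isCliffordFrame.quad_cyc_eq_increasing hQ.curvH_swap hQ.curvH_symm] at h1
  simp only [← hQ.metric_jacH] at h1
  change (24 : ℝ) • M.quartic Z M.jacH = _ at h1
  have h2 : ∑ i, ∑ j, curvH Q Z i j i j = M.scalarH Q Z := by
    simp only [hQ.curvH_eq]; rfl
  rw [h2] at h1
  rw [hQ.casimirLift_eq hZ X Y hXY]
  have h3 : (1 / 2 : ℝ) • M.quartic Z M.jacH = (1 / 48 : ℝ) • ((24 : ℝ) • M.quartic Z M.jacH) := by
    rw [smul_smul]; norm_num
  rw [h3, h1]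
  module

end Space
end Formula

/-! ### The square of the Dirac operator -/

section Dirac
namespace Space
variable {E : Type*} [NormedAddCommGroup E] [NormedSpace ℝ E]
  {G : Type*} [TopologicalSpace G] [ChartedSpace E G] [Group G]
  {H : Subgroup G} {M : Space E H} {n : ℕ} {Z : Module.Basis (Fin n) ℝ M.𝔪}
  {Δ : Type*} [NormedAddCommGroup Δ] [NormedSpace ℂ Δ]
  {c : M.Cl →ₐ[ℝ] Module.End ℂ Δ} {σ : M.SpinStructure} {ψ : G → Δ}

theorem leftDeriv_clifford [FiniteDimensional ℂ Δ] {φ : G → Δ} {g : G}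
    (hφ : MDifferentiableAt 𝓘(ℝ, E) 𝓘(ℝ, Δ) φ g) (a : M.Cl) (U : GroupLieAlgebra 𝓘(ℝ, E) G) :
    leftDeriv U (fun h => c a (φ h)) g = c a (leftDeriv U φ g) :=
  leftDeriv_linear_comp ((LinearMap.toContinuousLinearMap (c a)).restrictScalars ℝ) hφ U

theorem mdifferentiableAt_clifford [FiniteDimensional ℂ Δ] {φ : G → Δ} {g : G}
    (hφ : MDifferentiableAt 𝓘(ℝ, E) 𝓘(ℝ, Δ) φ g) (a : M.Cl) :
    MDifferentiableAt 𝓘(ℝ, E) 𝓘(ℝ, Δ) (fun h => c a (φ h)) g :=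
  (((LinearMap.toContinuousLinearMap (c a)).restrictScalars ℝ).mdifferentiableAt).comp g hφ

theorem IsOrthonormal.firstOrder_eq (hZ : M.IsOrthonormal Z) (g : G) :
    M.firstOrder c Z ψ g = ∑ i, ∑ j, c (M.inc (Z i) * M.inc (Z j)) (leftDeriv
      (M.brM (Z i) (Z j) : GroupLieAlgebra 𝓘(ℝ, E) G) ψ g) := by
  let D : GroupLieAlgebra 𝓘(ℝ, E) G →ₗ[ℝ] Δ :=
    { toFun := fun U => leftDeriv U ψ g
      map_add' := fun U V => leftDeriv_add_left U V ψ g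
      map_smul' := fun r U => leftDeriv_smul_left r U ψ g }
  refine Finset.sum_congr rfl fun i _ => Finset.sum_congr rfl fun j _ => ?_
  have h : leftDeriv (M.brM (Z i) (Z j) : GroupLieAlgebra 𝓘(ℝ, E) G) ψ g =
      ∑ k, torsion Z i j k • leftDeriv (Z k : GroupLieAlgebra 𝓘(ℝ, E) G) ψ g := by
    have h2 := congrArg (D ∘ₗ M.𝔪.subtype) (hZ.sum_metric_smul (M.brM (Z i) (Z j)))
    rw [map_sum] at h2
    simp only [map_smul] at h2
    exact h2.symm
  rw [h, map_sum]
  exact Finset.sum_congr rfl fun k _ => (LinearMap.map_smul_of_tower _ _ _).symm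

theorem quartic_add_smul (J K : M.𝔪 → M.𝔪 → M.𝔪 → M.𝔪) (a : ℝ) :
    (M.quartic Z fun U V W => J U V W + a • K U V W) = M.quartic Z J + a • M.quartic Z K := by
  simp only [quartic, map_add, map_smul, smul_eq_mul, add_smul, mul_smul, Finset.sum_add_distrib,
    Finset.smul_sum]

variable [FiniteDimensional ℝ E] [LieGroup 𝓘(ℝ, E) ∞ G]

/-- The Dirac operator differs from the one for `t = 0` by a multiple of the Clifford cubic. -/
theorem IsOrthonormal.dirac_eq (hZ : M.IsOrthonormal Z) (t : ℝ) (φ : G → Δ) (g : G) :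
    M.dirac c Z t φ g = ∑ i, c (M.inc (Z i)) (leftDeriv (Z i : GroupLieAlgebra 𝓘(ℝ, E) G) φ g) +
      (t / 4) • c (cubic Z) (φ g) := by
  have h : (t / 4) • cubic Z = ∑ i, M.inc (Z i) * M.spinLift (M.Lam t (Z i)) := by
    simp only [hZ.spinLift_Lam, mul_smul_comm, ← Finset.smul_sum, cubic, Finset.mul_sum, mul_assoc,
      torsion]
  rw [← LinearMap.smul_apply, ← map_smul, h]
  simp only [dirac, nabla, map_add, Finset.sum_add_distrib, map_sum, map_mul, LinearMap.sum_apply,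
    Module.End.mul_apply]

theorem IsOrthonormal.leftDeriv_dirac [FiniteDimensional ℂ Δ] (hZ : M.IsOrthonormal Z)
    (hψ : ContMDiff 𝓘(ℝ, E) 𝓘(ℝ, Δ) ∞ ψ) (t : ℝ) (U : GroupLieAlgebra 𝓘(ℝ, E) G) (g : G) :
    leftDeriv U (M.dirac c Z t ψ) g = ∑ j, c (M.inc (Z j)) (leftDeriv U
      (leftDeriv (Z j : GroupLieAlgebra 𝓘(ℝ, E) G) ψ) g) +
        (t / 4) • c (cubic Z) (leftDeriv U ψ g) := by
  have h1 : MDifferentiableAt 𝓘(ℝ, E) 𝓘(ℝ, Δ) ψ g := hψ.mdifferentiable (by simp) g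
  have h2 : ∀ j, MDifferentiableAt 𝓘(ℝ, E) 𝓘(ℝ, Δ)
      (leftDeriv (Z j : GroupLieAlgebra 𝓘(ℝ, E) G) ψ) g := fun j => mdifferentiable_leftDeriv hψ _ g
  have h3 : M.dirac c Z t ψ = fun h => (∑ j, c (M.inc (Z j))
      (leftDeriv (Z j : GroupLieAlgebra 𝓘(ℝ, E) G) ψ h)) + c ((t / 4) • cubic Z) (ψ h) := by
    funext h
    rw [hZ.dirac_eq, map_smul, LinearMap.smul_apply]
  rw [h3, leftDeriv_add _ (mdifferentiableAt_clifford h1 _), leftDeriv_sum,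
    leftDeriv_clifford h1, map_smul, LinearMap.smul_apply]
  · simp only [leftDeriv_clifford (h2 _)]
  · exact fun j _ => mdifferentiableAt_clifford (h2 j) _
  · have h4 := MDifferentiableAt.sum (t := Finset.univ) (f := fun j h => c (M.inc (Z j))
      (leftDeriv (Z j : GroupLieAlgebra 𝓘(ℝ, E) G) ψ h)) fun j _ =>
        mdifferentiableAt_clifford (h2 j) _
    convert h4 using 1
    ext h
    simp

/-- The commutators of the second derivatives in `∑ Z_i · Z_j · Z_i(Z_j(ψ))` are derivatives along
`[Z_i, Z_j]`, whose `𝔥`-part acts by Clifford multiplication. -/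
theorem IsSpinorField.sum_second_deriv (hψ : M.IsSpinorField c σ ψ) (hZ : M.IsOrthonormal Z)
    {Q : LinearMap.BilinForm ℝ (GroupLieAlgebra 𝓘(ℝ, E) G)} (hQ : M.IsInvariantExtension Q)
    (g : G) :
    ∑ i, ∑ j, c (M.inc (Z i) * M.inc (Z j)) (leftDeriv (Z i : GroupLieAlgebra 𝓘(ℝ, E) G)
      (leftDeriv (Z j : GroupLieAlgebra 𝓘(ℝ, E) G) ψ) g) =
    -(∑ i, leftDeriv (Z i : GroupLieAlgebra 𝓘(ℝ, E) G)
      (leftDeriv (Z i : GroupLieAlgebra 𝓘(ℝ, E) G) ψ) g) + (1 / 2 : ℝ) • M.firstOrder c Z ψ g +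
      c ((-1 / 8 : ℝ) • quad (fun i => M.inc (Z i)) (curvH Q Z)) (ψ g) := by
  set F : Fin n → Fin n → Δ := fun i j => leftDeriv (Z i : GroupLieAlgebra 𝓘(ℝ, E) G)
      (leftDeriv (Z j : GroupLieAlgebra 𝓘(ℝ, E) G) ψ) g with hF
  -- the antisymmetric part of the second derivatives
  have hcomm : ∀ i j, F i j - F j i = leftDeriv (M.brM (Z i) (Z j) : GroupLieAlgebra 𝓘(ℝ, E) G) ψ g -
      c (adBivector Q Z (M.brH (Z i) (Z j))) (ψ g) := by
    intro i j
    rw [hF, leftDeriv_commutator hψ.smooth, sub_eq_add_neg,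
      ← hψ.leftDeriv_of_mem hQ hZ (M.brH (Z i) (Z j)).2, ← leftDeriv_add_left]
    exact congrArg (fun U => leftDeriv U ψ g) (prM_add_prH (M := M) (M.br (Z i) (Z j))).symm
  have hquad : ∑ i, ∑ j, c (M.inc (Z i) * M.inc (Z j))
      (c (adBivector Q Z (M.brH (Z i) (Z j))) (ψ g)) =
      c ((1 / 4 : ℝ) • quad (fun i => M.inc (Z i)) (curvH Q Z)) (ψ g) := by
    have h : (1 / 4 : ℝ) • quad (fun i => M.inc (Z i)) (curvH Q Z) =
        ∑ i, ∑ j, M.inc (Z i) * M.inc (Z j) * adBivector Q Z (M.brH (Z i) (Z j)) := by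
      simp only [adBivector_apply, mul_smul_comm, ← Finset.smul_sum, Finset.mul_sum, quad, curvH,
        mul_assoc]
    rw [h]
    simp only [map_sum, map_mul, LinearMap.sum_apply, Module.End.mul_apply]
  -- the symmetric part of the products leaves the diagonal
  have hdiag : ∑ i, ∑ j, (c (M.inc (Z i) * M.inc (Z j)) (F j i) +
      c (M.inc (Z j) * M.inc (Z i)) (F j i)) = (-2 : ℝ) • ∑ i, F i i := by
    rw [Finset.smul_sum]
    refine Finset.sum_congr rfl fun i _ => ?_
    have h : ∀ j, c (M.inc (Z i) * M.inc (Z j)) (F j i) + c (M.inc (Z j) * M.inc (Z i)) (F j i) =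
        if i = j then (-2 : ℝ) • F i i else 0 := by
      intro j
      rw [← LinearMap.add_apply, ← map_add, hZ.isCliffordFrame i j]
      split_ifs with hij
      · subst hij
        rw [map_neg, map_ofNat]
        simp [two_smul, ofNat_smul_eq_nsmul]
      · rw [map_zero, LinearMap.zero_apply]
    simp only [h, Finset.sum_ite_eq, Finset.mem_univ, if_true]
  have hswap : ∑ i, ∑ j, c (M.inc (Z j) * M.inc (Z i)) (F j i) =
      ∑ i, ∑ j, c (M.inc (Z i) * M.inc (Z j)) (F i j) := Finset.sum_comm
  have h2 : (2 : ℝ) • ∑ i, ∑ j, c (M.inc (Z i) * M.inc (Z j)) (F i j) =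
      ∑ i, ∑ j, c (M.inc (Z i) * M.inc (Z j)) (F i j - F j i) + (-2 : ℝ) • ∑ i, F i i := by
    rw [← hdiag]
    simp only [map_sub, Finset.sum_sub_distrib, Finset.sum_add_distrib]
    rw [hswap, two_smul]; abel
  simp only [hcomm, map_sub, Finset.sum_sub_distrib] at h2
  rw [hquad, ← hZ.firstOrder_eq] at h2
  have h3 := congrArg (fun x => (1 / 2 : ℝ) • x) h2
  simp only [smul_smul] at h3
  norm_num only [one_smul] at h3
  rw [h3, map_smul, map_smul, LinearMap.smul_apply, LinearMap.smul_apply]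
  module

/-- The square of the Dirac operator, before the quartic and scalar terms are separated. -/
theorem IsSpinorField.dirac_dirac [FiniteDimensional ℂ Δ] (hψ : M.IsSpinorField c σ ψ)
    (hZ : M.IsOrthonormal Z)
    {Q : LinearMap.BilinForm ℝ (GroupLieAlgebra 𝓘(ℝ, E) G)} (hQ : M.IsInvariantExtension Q)
    (t : ℝ) (g : G) :
    M.dirac c Z t (M.dirac c Z t ψ) g =
      -(∑ i, leftDeriv (Z i : GroupLieAlgebra 𝓘(ℝ, E) G)
        (leftDeriv (Z i : GroupLieAlgebra 𝓘(ℝ, E) G) ψ) g) +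
      ((1 / 2 : ℝ) * (1 - 3 * t)) • M.firstOrder c Z ψ g +
      c ((-1 / 8 : ℝ) • quad (fun i => M.inc (Z i)) (curvH Q Z)) (ψ g) +
      (t ^ 2 / 16) • c (cubic Z * cubic Z) (ψ g) := by
  -- the anticommutators of the cubic with the vectors `Z_k` add up to the first order operator
  have hfirst : ∑ k, c (M.inc (Z k) * cubic Z + cubic Z * M.inc (Z k))
      (leftDeriv (Z k : GroupLieAlgebra 𝓘(ℝ, E) G) ψ g) = (-6 : ℝ) • M.firstOrder c Z ψ g := by
    have h : ∀ k, M.inc (Z k) * cubic Z + cubic Z * M.inc (Z k) =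
        (-6 : ℝ) • ∑ i, ∑ j, torsion Z i j k • (M.inc (Z i) * M.inc (Z j)) := fun k =>
      hZ.isCliffordFrame.cubic_anticommutator (T := torsion Z) torsion_swap torsion_swap_right k
    simp only [h, map_smul, LinearMap.smul_apply, ← Finset.smul_sum, map_sum, LinearMap.sum_apply]
    exact congrArg _ (sum_rotate fun i j k => torsion Z i j k •
      c (M.inc (Z i) * M.inc (Z j)) (leftDeriv (Z k : GroupLieAlgebra 𝓘(ℝ, E) G) ψ g))
  rw [hZ.dirac_eq, hZ.dirac_eq]
  simp only [hZ.leftDeriv_dirac hψ.smooth, map_add, map_sum, Finset.sum_add_distrib,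
    ← Module.End.mul_apply, ← map_mul]
  rw [hψ.sum_second_deriv hZ hQ]
  have hsmul : ∀ (a : M.Cl) (s : ℝ) (v : Δ), c a (s • v) = s • c a v := fun a s v =>
    LinearMap.map_smul_of_tower _ _ _
  simp only [hsmul, ← Finset.smul_sum, ← Module.End.mul_apply, ← map_mul]
  simp only [map_add, LinearMap.add_apply, Finset.sum_add_distrib] at hfirst
  rw [eq_sub_of_add_eq hfirst]
  module

end Space
end Dirac

end NatRed

end

theorem mainTheorem1
    {E : Type*} [NormedAddCommGroup E] [NormedSpace ℝ E] [FiniteDimensional ℝ E]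
    {G : Type*} [TopologicalSpace G] [ChartedSpace E G] [Group G] [LieGroup 𝓘(ℝ, E) ∞ G]
    {H : Subgroup G} (hH : IsClosed (H : Set G))
    (M : NatRed.Space E H) (σ : M.SpinStructure)
    {Δ : Type*} [NormedAddCommGroup Δ] [NormedSpace ℂ Δ] [FiniteDimensional ℂ Δ]
    (c : M.Cl →ₐ[ℝ] Module.End ℂ Δ) (hc : M.IsSpinorModule c)
    (Q : LinearMap.BilinForm ℝ (GroupLieAlgebra 𝓘(ℝ, E) G)) (hQ : M.IsInvariantExtension Q)
    {n : ℕ} (Z : Module.Basis (Fin n) ℝ M.𝔪)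
    (hZ : ∀ i j, M.metric (Z i) (Z j) = if i = j then 1 else 0)
    {r : ℕ} (X Y : Module.Basis (Fin r) ℝ (NatRed.lieAlg E H))
    (hXY : ∀ i j, Q (X i) (Y j) = if i = j then 1 else 0)
    (t : ℝ) (ψ : G → Δ) (hψ : M.IsSpinorField c σ ψ) :
    (5 ≤ n → ∀ g : G,
      M.dirac c Z t (M.dirac c Z t ψ) g =
        M.Omega c Z X Y ψ g
          + ((1 / 2 : ℝ) * (1 - 3 * t)) • M.firstOrder c Z ψ g
          - (1 / 2 : ℝ) • c (M.quartic Z fun U V W =>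
              M.jacH U V W + (9 * t ^ 2) • M.jacM U V W) (ψ g)
          + ((1 / 8 : ℝ) * M.scalarH Q Z) • ψ g
          + ((3 / 8 : ℝ) * t ^ 2 * M.scalarM Q Z) • ψ g) ∧
    (n ≤ 4 → ∀ g : G,
      M.dirac c Z t (M.dirac c Z t ψ) g =
        M.Omega c Z X Y ψ g
          + ((1 / 2 : ℝ) * (1 - 3 * t)) • M.firstOrder c Z ψ g
          - (1 / 2 : ℝ) • c (M.quartic Z M.jacH) (ψ g)
          + ((1 / 8 : ℝ) * M.scalarH Q Z) • ψ g
          + ((3 / 8 : ℝ) * t ^ 2 * M.scalarM Q Z) • ψ g) := by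
  have hZ' : M.IsOrthonormal Z := hZ
  have key : ∀ g, M.dirac c Z t (M.dirac c Z t ψ) g =
      M.Omega c Z X Y ψ g + ((1 / 2 : ℝ) * (1 - 3 * t)) • M.firstOrder c Z ψ g
        - (1 / 2 : ℝ) • (c (M.quartic Z M.jacH) (ψ g) +
          (9 * t ^ 2) • c (M.quartic Z M.jacM) (ψ g))
        + ((1 / 8 : ℝ) * M.scalarH Q Z) • ψ g + ((3 / 8 : ℝ) * t ^ 2 * M.scalarM Q Z) • ψ g := by
    intro g
    rw [hψ.dirac_dirac hZ' hQ, hQ.quad_curvH hZ' X Y hXY, hQ.cubic_sq hZ', NatRed.Space.Omega]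
    simp only [map_add, map_sub, map_smul, map_one, LinearMap.add_apply, LinearMap.sub_apply,
      LinearMap.smul_apply, Module.End.one_apply]
    module
  refine ⟨fun _ g => ?_, fun hn g => ?_⟩
  · rw [key, NatRed.Space.quartic_add_smul, map_add, map_smul, LinearMap.add_apply, LinearMap.smul_apply]
  · rw [key, hZ'.quartic_jacM_eq_zero hn, map_zero, LinearMap.zero_apply, smul_zero, add_zero]
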